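/- **Conventions.** Fix an integer $e\ge 2$. A partition $\lambda=(\lambda_1\ge\lambda_2\ge\cdots)$ has the set of beta-numbers $\beta(\lambda)=\{\lambda_i-i\mid i\ge 1\}\subset\mathbb Z$, called beads, placed on an abacus with $e$ runners (the residue classes modulo $e$). For $b\in\mathbb Z$ let $\operatorname{wt}_\lambda(b)=|\{x<b\mid x\equiv b \ (\mathrm{mod}\ e),\ x\notin\beta(\lambda)\}|$. The $e$-weight of $\lambda$ is $\sum_{b\in\beta(\lambda)}\operatorname{wt}_\lambda(b)$; a partition of $e$-weight $0$ is an $e$-core. The $e$-core of $\lambda$ is the partition $\kappa$ with $\beta(\kappa)=\{b-\operatorname{wt}_\lambda(b)e\mid b\in\beta(\lambda)\}$. For an $e$-core $\kappa$ and $w\in\mathbb Z_{\ge0}$, the block $B_{\kappa,w}$ is the set of partitions with $e$-core $\kappa$ and $e$-weight $w$. The $e$-quotient of $\lambda$ is $(\lambda^{(0)},\dots,\lambda^{(e-1)})$, where the nonzero parts of $\lambda^{(r)}$ are the nonzero $\operatorname{wt}_\lambda(b)$ for $b\in\beta(\lambda)$, $b\equiv r\ (\mathrm{mod}\ e)$.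 We call $\lambda$ a hook-quotient partition if every $\lambda^{(r)}$ is a hook, i.e. has second part at most $1$. Let $\lambda$ have $e$-weight $w$. Its bead movements are the $w$ pairs $(b;q)$ with $b\in\beta(\lambda)$ and $q=b-ie$ for some integer $0\le i<\operatorname{wt}_\lambda(b)$. List them as $(b_1;q_1)<\dots<(b_w;q_w)$, ordered first by $q$ and then by $b$. The label of $\lambda$ is $\mathbf z(\lambda)=(z_1,\dots,z_w)$, where $z_i=|(q_i-e,q_i]\cap\mathbb Z\setminus\beta(\lambda)|$. If $\lambda$ is a hook-quotient partition, define $\epsilon_1^\lambda,\dots,\epsilon_w^\lambda\in\mathbb Z^w$ as follows, where $\mathbf e_1,\dots,\mathbf e_w$ is the standard basis. For each residue class $j$ modulo $e$ such that $\{i\mid q_i\equiv j \ (\mathrm{mod}\ e)\}=\{i_1<\dots<i_r\}$ is nonempty, let $l=\min\{s\mid b_{i_s}=b_{i_r}\}$, and put $\epsilon^\lambda_{i_\gamma}=\mathbf e_{i_\gamma}-\mathbf e_{i_{\gamma+1}}$ if $\gamma<l$, $\epsilon^\lambda_{i_\gamma}=\mathbf e_{i_\gamma}$ if $\gamma=l$,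 and $\epsilon^\lambda_{i_\gamma}=\mathbf e_{i_\gamma}-\mathbf e_{i_{\gamma-1}}$ if $\gamma>l$. Let $$\Pi(\lambda)=\Big\{\mathbf z(\lambda)+\sum_{i\in\Gamma}\epsilon_i^\lambda\ \Big|\ \Gamma\subseteq\{1,\dots,w\}\Big\}\subset\mathbb Z^w .$$ The solid parallelotope $\Pi(\lambda)^{\mathbb R}$ is the convex hull of $\Pi(\lambda)$ in $\mathbb R^w$, and the half-open solid parallelotope is $$\Pi(\lambda)^{\mathbb R}_{<}=\Big\{\mathbf z(\lambda)+\sum_{i=1}^w a_i\epsilon_i^\lambda\ \Big|\ 0\le a_i<1 \text{ for all } i\Big\}\subset\mathbb R^w .$$ For $\Omega\subseteq\mathbb R^w$ let $\Omega_{\ge 4}$ be the set of its $4$-increasing points, i.e. of those $(x_1,\dots,x_w)\in\Omega$ with $x_{i+1}-x_i\ge4$ for all $1\le i<w$. **Proposition 8.3.** Let $w\ge 0$ be an integer and let $B$ be a block of $e$-weight $w$. Then $$\coprod_{\lambda}\big(\Pi(\lambda)^{\mathbb R}_{<}\big)_{\ge4}=\big([0,e)^w\big)_{\ge4},\qquad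 \bigcup_{\lambda}\big(\Pi(\lambda)^{\mathbb R}\big)_{\ge4}=\big([0,e]^w\big)_{\ge4},$$ where both unions are taken over all hook-quotient partitions $\lambda\in B$ and $[0,e)$, $[0,e]$ are real intervals. The first union is disjoint: the sets indexed by distinct $\lambda$ are disjoint. -/

import Mathlib

namespace HookTiling

/-! ### Partitions, beta-numbers and the abacus

A partition is a `YoungDiagram`; its parts are `lam.rowLen 0 ≥ lam.rowLen 1 ≥ …`
(eventually zero). -/

/-- The set of beta-numbers `{lam_1 - 1, lam_2 - 2, …}` (the parts are indexed from `0` here). -/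
def beta (lam : YoungDiagram) : Set ℤ :=
  Set.range fun i : ℕ => (lam.rowLen i : ℤ) - ((i : ℤ) + 1)

/-- The unoccupied positions strictly above `b` on the runner of `b` of the `e`-abacus. -/
def gaps (e : ℕ) (lam : YoungDiagram) (b : ℤ) : Set ℤ :=
  {x | x ≡ b [ZMOD e] ∧ x < b ∧ x ∉ beta lam}

/-- `wt_lam(b)`: the number of unoccupied positions above `b` on its runner. -/
noncomputable def wt (e : ℕ) (lam : YoungDiagram) (b : ℤ) : ℕ :=
  (gaps e lam b).ncard

theorem mem_beta_of_lt (lam : YoungDiagram) (x : ℤ) (hx : x < -(lam.colLen 0 : ℤ)) :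
    x ∈ beta lam := by
  refine ⟨(-x - 1).toNat, ?_⟩
  have h : lam.rowLen (-x - 1).toNat = 0 := by
    by_contra h0
    have h1 : ((-x - 1).toNat, 0) ∈ lam :=
      YoungDiagram.mem_iff_lt_rowLen.2 (Nat.pos_of_ne_zero h0)
    have h2 := YoungDiagram.mem_iff_lt_colLen.1 h1
    omega
  simp only [h]
  omega

theorem beta_lt (lam : YoungDiagram) (x : ℤ) (hx : x ∈ beta lam) : x < lam.rowLen 0 := by
  obtain ⟨i, rfl⟩ := hx
  have := lam.rowLen_anti 0 i (Nat.zero_le i)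
  dsimp only
  omega

theorem gaps_finite (e : ℕ) (lam : YoungDiagram) (b : ℤ) : (gaps e lam b).Finite := by
  refine (Set.finite_Ico (-(lam.colLen 0 : ℤ)) b).subset ?_
  rintro x ⟨-, h1, h2⟩
  refine ⟨?_, h1⟩
  by_contra h
  exact h2 (mem_beta_of_lt lam x (not_le.1 h))

theorem activeBeads_finite (e : ℕ) (lam : YoungDiagram) :
    {b : ℤ | b ∈ beta lam ∧ 0 < wt e lam b}.Finite := by
  refine (Set.finite_Ico (-(lam.colLen 0 : ℤ)) (lam.rowLen 0 : ℤ)).subset ?_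
  rintro b ⟨h1, h2⟩
  refine ⟨?_, beta_lt lam b h1⟩
  obtain ⟨x, -, h3, h4⟩ := Set.nonempty_of_ncard_ne_zero (Nat.pos_iff_ne_zero.1 h2)
  by_contra h
  exact h4 (mem_beta_of_lt lam x (by omega))

/-- The finitely many beads of positive `e`-weight. -/
noncomputable def activeBeads (e : ℕ) (lam : YoungDiagram) : Finset ℤ :=
  (activeBeads_finite e lam).toFinset

/-- The `e`-weight of a partition: the sum of the `e`-weights of all its beads
(only the active beads contribute). -/
noncomputable def eWeight (e : ℕ) (lam : YoungDiagram) : ℕ :=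
  ∑ b ∈ activeBeads e lam, wt e lam b

/-! ### Cores and blocks -/

/-- An `e`-core is a partition of `e`-weight `0`. -/
def IsECore (e : ℕ) (kap : YoungDiagram) : Prop :=
  eWeight e kap = 0

/-- `kap` is the `e`-core of `lam`: its abacus display is obtained from that of `lam` by sliding
every bead up its runner as far as possible, so that the bead at `b` moves past
the `wt_lam(b)` gaps above it and ends at `b - wt_lam(b) e`. -/
def IsECoreOf (e : ℕ) (kap lam : YoungDiagram) : Prop :=
  beta kap = (fun b : ℤ => b - (wt e lam b : ℤ) * e) '' beta lam

/-- The block `B_{kap,w}`: the partitions with `e`-core `kap` and `e`-weight `w`. -/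
def block (e : ℕ) (kap : YoungDiagram) (w : ℕ) : Set YoungDiagram :=
  {lam | IsECoreOf e kap lam ∧ eWeight e lam = w}

/-! ### The `e`-quotient and hook-quotient partitions -/

/-- The component on runner `r` of the `e`-quotient of `lam`: the partition whose nonzero parts
are the nonzero `wt_lam(b)` for the beads `b ≡ r` modulo `e`, with multiplicity. -/
noncomputable def eQuotient (e : ℕ) (lam : YoungDiagram) (r : ℕ) : YoungDiagram :=
  YoungDiagram.ofRowLens
    ((((activeBeads e lam).filter fun b => b ≡ r [ZMOD e]).val.map (wt e lam)).sort (· ≥ ·))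
    (Multiset.pairwise_sort _ _).sortedGE

/-- A hook is a partition whose second part is at most `1` (the empty partition is one). -/
def IsHook (mu : YoungDiagram) : Prop :=
  mu.rowLen 1 ≤ 1

/-- All components of the `e`-quotient are hooks. -/
def IsHookQuotient (e : ℕ) (lam : YoungDiagram) : Prop :=
  ∀ r < e, IsHook (eQuotient e lam r)

/-- The hook-quotient partitions in the block `B_{kap,w}`. -/
def hookQuotientBlock (e : ℕ) (kap : YoungDiagram) (w : ℕ) : Set YoungDiagram :=
  {lam | lam ∈ block e kap w ∧ IsHookQuotient e lam}

/-! ### Bead movements and the label of a partition -/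

/-- The bead movements of `lam`. The movement of the bead `b` that starts at `q` is stored as the
pair `(q, b)`, so that the lexicographic order compares starting positions first, and then the
original positions of the beads. -/
noncomputable def movements (e : ℕ) (lam : YoungDiagram) : Finset (ℤ ×ₗ ℤ) :=
  (activeBeads e lam).biUnion fun b =>
    (Finset.range (wt e lam b)).image fun i : ℕ => toLex (b - (i : ℤ) * e, b)

theorem mem_movements (e : ℕ) (lam : YoungDiagram) (q b : ℤ) :
    toLex (q, b) ∈ movements e lam ↔
      b ∈ beta lam ∧ ∃ i : ℕ, i < wt e lam b ∧ q = b - (i : ℤ) * e := by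
  simp only [movements, activeBeads, Finset.mem_biUnion, Set.Finite.mem_toFinset, Set.mem_ofPred_eq,
    Finset.mem_image, Finset.mem_range, toLex_inj, Prod.mk.injEq]
  constructor
  · rintro ⟨c, ⟨h1, -⟩, i, h2, rfl, rfl⟩
    exact ⟨h1, i, h2, rfl⟩
  · rintro ⟨h1, i, h2, rfl⟩
    exact ⟨b, ⟨h1, by omega⟩, i, h2, rfl, rfl⟩

theorem card_movements (e : ℕ) (lam : YoungDiagram) :
    (movements e lam).card = eWeight e lam := by
  rw [movements, Finset.card_biUnion, eWeight]
  · refine Finset.sum_congr rfl fun b _ => ?_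
    rcases Nat.eq_zero_or_pos e with rfl | he
    · have h0 : wt 0 lam b = 0 := by
        have : gaps 0 lam b = ∅ := by
          ext x
          simp only [gaps, Set.mem_ofPred_eq, Set.mem_empty_iff_false, iff_false]
          rintro ⟨h1, h2, -⟩
          have : x = b := by simpa [Int.ModEq] using h1
          omega
        simp [wt, this]
      simp [h0]
    · rw [Finset.card_image_of_injective, Finset.card_range]
      intro i j hij
      have h1 : b - (i : ℤ) * e = b - (j : ℤ) * e := congrArg (fun p => (ofLex p).1) hij
      have h2 : (i : ℤ) * e = (j : ℤ) * e := by linarith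
      exact_mod_cast mul_right_cancel₀ (by exact_mod_cast he.ne') h2
  · intro b _ c _ hbc
    refine Finset.disjoint_left.2 fun p hp hp' => hbc ?_
    obtain ⟨i, -, rfl⟩ := Finset.mem_image.1 hp
    obtain ⟨j, -, h⟩ := Finset.mem_image.1 hp'
    exact (congrArg (fun p => (ofLex p).2) h).symm

/-- The `i`-th bead movement of `lam` in increasing order (indexed from `0`). -/
noncomputable def movement (e : ℕ) {lam : YoungDiagram} {w : ℕ} (h : eWeight e lam = w)
    (i : Fin w) : ℤ ×ₗ ℤ :=
  (movements e lam).orderEmbOfFin ((card_movements e lam).trans h) i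

/-- The starting position `q_i` of the `i`-th bead movement. -/
noncomputable def startPos (e : ℕ) {lam : YoungDiagram} {w : ℕ} (h : eWeight e lam = w)
    (i : Fin w) : ℤ :=
  (ofLex (movement e h i)).1

/-- The original position `b_i` of the bead of the `i`-th bead movement. -/
noncomputable def beadPos (e : ℕ) {lam : YoungDiagram} {w : ℕ} (h : eWeight e lam = w)
    (i : Fin w) : ℤ :=
  (ofLex (movement e h i)).2

/-- `z_S(x)`, the number of integers in `(x - e, x]` that are not in `S`. -/
noncomputable def armLength (e : ℕ) (S : Set ℤ) (x : ℤ) : ℕ :=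
  (Set.Ioc (x - e) x \ S).ncard

/-- The label `z(lam) = (z_1, …, z_w)` of a partition of `e`-weight `w`. -/
noncomputable def label (e : ℕ) {lam : YoungDiagram} {w : ℕ} (h : eWeight e lam = w) :
    Fin w → ℤ :=
  fun i => armLength e (beta lam) (startPos e h i)

/-! ### Modified basis vectors -/

section ModifiedBasis

variable (e : ℕ) {w : ℕ} (q b : Fin w → ℤ)

/-- The indices `i_1 < … < i_r` of the movements on the runner of the `i`-th movement. -/
def runner (i : Fin w) : Finset (Fin w) :=
  Finset.univ.filter fun k => q k ≡ q i [ZMOD e]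

theorem self_mem_runner (i : Fin w) : i ∈ runner e q i := by
  simp [runner]

/-- The last index `i_r` on the runner of the `i`-th movement. -/
def lastIdx (i : Fin w) : Fin w :=
  (runner e q i).max' ⟨i, self_mem_runner e q i⟩

theorem pivot_nonempty (i : Fin w) :
    ((runner e q i).filter fun k => b k = b (lastIdx e q i)).Nonempty :=
  ⟨lastIdx e q i, Finset.mem_filter.2 ⟨Finset.max'_mem _ _, rfl⟩⟩

/-- The index `i_l` on the runner of the `i`-th movement, where `l = min {s | b_{i_s} = b_{i_r}}`. -/
def pivot (i : Fin w) : Fin w :=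
  ((runner e q i).filter fun k => b k = b (lastIdx e q i)).min' (pivot_nonempty e q b i)

theorem pivot_mem_runner (i : Fin w) : pivot e q b i ∈ runner e q i :=
  (Finset.mem_filter.1 (Finset.min'_mem _ (pivot_nonempty e q b i))).1

/-- The index following `i` on its runner, if `i` is before the pivot. -/
def nextIdx (i : Fin w) (h : i < pivot e q b i) : Fin w :=
  ((runner e q i).filter fun k => i < k).min'
    ⟨pivot e q b i, Finset.mem_filter.2 ⟨pivot_mem_runner e q b i, h⟩⟩

/-- The index preceding `i` on its runner, if `i` is after the pivot. -/
def prevIdx (i : Fin w) (h : pivot e q b i < i) : Fin w :=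
  ((runner e q i).filter fun k => k < i).max'
    ⟨pivot e q b i, Finset.mem_filter.2 ⟨pivot_mem_runner e q b i, h⟩⟩

/-- The `i`-th modified basis vector of the movements with starting positions `q` and original
bead positions `b`. -/
def modifiedBasis (i : Fin w) : Fin w → ℤ :=
  if h : i < pivot e q b i then Pi.single i 1 - Pi.single (nextIdx e q b i h) 1
  else if h' : pivot e q b i < i then Pi.single i 1 - Pi.single (prevIdx e q b i h') 1
  else Pi.single i 1

end ModifiedBasis

/-- The `lam`-modified basis vector `ε_i`. -/
noncomputable def eps (e : ℕ) {lam : YoungDiagram} {w : ℕ} (h : eWeight e lam = w) (i : Fin w) :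
    Fin w → ℤ :=
  modifiedBasis e (startPos e h) (beadPos e h) i

/-! ### Parallelotopes and regions -/

/-- The discrete parallelotope `Π(lam) = {z(lam) + ∑_{i ∈ Γ} ε_i | Γ}`. -/
noncomputable def parallelotope (e : ℕ) {lam : YoungDiagram} {w : ℕ} (h : eWeight e lam = w) :
    Set (Fin w → ℤ) :=
  Set.range fun G : Finset (Fin w) => label e h + ∑ i ∈ G, eps e h i

/-- An integer vector as a real vector. -/
def toReal {w : ℕ} (v : Fin w → ℤ) : Fin w → ℝ :=
  fun i => (v i : ℝ)

/-- The solid parallelotope: the convex hull of `Π(lam)` in real `w`-space. -/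
noncomputable def solid (e : ℕ) {lam : YoungDiagram} {w : ℕ} (h : eWeight e lam = w) :
    Set (Fin w → ℝ) :=
  convexHull ℝ (toReal '' parallelotope e h)

/-- The half-open solid parallelotope `{z(lam) + ∑ a_i ε_i | 0 ≤ a_i < 1}`. -/
noncomputable def halfOpenSolid (e : ℕ) {lam : YoungDiagram} {w : ℕ} (h : eWeight e lam = w) :
    Set (Fin w → ℝ) :=
  {x | ∃ a : Fin w → ℝ, (∀ i, 0 ≤ a i ∧ a i < 1) ∧
    x = toReal (label e h) + ∑ i, a i • toReal (eps e h i)}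

/-- The `m`-increasing points of a set: those with `x_{i+1} - x_i ≥ m` for all admissible `i`. -/
def increasing (m : ℝ) {w : ℕ} (O : Set (Fin w → ℝ)) : Set (Fin w → ℝ) :=
  {x | x ∈ O ∧ ∀ i j : Fin w, (i : ℕ) + 1 = j → m ≤ x j - x i}

/-- The cube `[0,e]^w`. -/
def cube (e w : ℕ) : Set (Fin w → ℝ) :=
  {x | ∀ i, 0 ≤ x i ∧ x i ≤ e}

/-- The half-open cube `[0,e)^w`. -/
def halfOpenCube (e w : ℕ) : Set (Fin w → ℝ) :=
  {x | ∀ i, 0 ≤ x i ∧ x i < e}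

end HookTiling

/-!
The tiles are the subdifferentials of a convex function at its vertices, and the tiling expresses
that every slope in the cube is attained by such a vertex.

The core has on runner `r` of the abacus exactly the beads below a position `P r`. A hook-quotient
partition of the block has on each runner one bead moved from a gap `g r < P r` to a top position
`T r ≥ P r`, or nothing moved; its bead movements start at the positions `y` with `g y < y ≤ T y`.
Hence `lam` amounts to the increasing sequence `q` of its starting positions, a configuration
which on every runner is empty or an unbroken interval through `P r` (`IsHookConfig`,
`IsHookAbacus.isHookConfig`, `exists_partition`). On sequences of integers put
`E(q) = ∑_i ∑_r (q_i - P_r)⁺ + ∑_{i<k} (e + q_i - q_k)⁺`.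
Call `x` a subgradient of `E` at `q` if `⟨x, v⟩ ≤ E(q + v) - E(q)` for all integer `v`.

*Tiles are subdifferentials.* At a configuration `q` exactly one kink of `E` is active for every
index `i`, namely `q_i = P_r` or `|q_i - q_k| = e` for a neighbour `k` on the runner, and its
direction is the modified basis vector `ε_i` up to sign. So
`E(q + v) ≥ E(q) + ⟨z, v⟩ + ∑_i ⟨ε_i, v⟩⁺`, with equality for small `v` (`energy_add_sub`), where
`z` is the label (`IsHookAbacus.label_eq`). The basis dual to `ε` consists of indicator vectors of
parts of runners (`sum_dualSet_basis`), along which equality holds. It follows that the solid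
parallelotope is the set of subgradients of `E` at `q` (`IsHookAbacus.mem_solid_iff`).

*Covering.* If `x` lies in the open cube, then `⟨x, q⟩ - E(q)` has a maximum. When the coordinates
of `x` increase by more than `3`, a maximizer is strictly increasing (`IsSubgradient.strictMono`), and
one with the largest `∑ q_i²` is a configuration: a part of a runner not tied to any `P r` could be
shifted both ways without changing the value (`shiftable_eq_empty`). Other points `x` are limits of
such points, along a segment moving all coordinates up (half-open case) or towards the centre of
the cube (closed case); there are finitely many configurations, so one serves for points
arbitrarily near to `x`.

*Containment and disjointness.* Lowering the first or raising the last coordinate of `q` bounds the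
coordinates of a subgradient by `0` and `e`. If `x` lies in the half-open tiles of `q` and `q'`,
then `x + u` is a subgradient at both for all small `u ≥ 0`; so `⟨x + u, q - q'⟩` does not depend on
`u`, whence `q = q'`.
-/

namespace HookTiling

/-! ### The energy of a configuration -/

section Energy

variable {e w : ℕ}

theorem intCast_add_self (x : ℤ) : ((x + e : ℤ) : ZMod e) = x := by simp

theorem intCast_sub_self (x : ℤ) : ((x - e : ℤ) : ZMod e) = x := by simp

theorem add_le_of_lt_of_cast_eq {x y : ℤ} (h : x < y) (hxy : (x : ZMod e) = y) : x + e ≤ y := by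
  have h1 : (e : ℤ) ∣ y - x := (ZMod.intCast_eq_intCast_iff_dvd_sub x y e).1 hxy
  have := Int.le_of_dvd (by omega) h1
  omega

/-- The part of the runner of `i` on the far side of `i`, as seen from the base point, including
`i`; the whole runner if `i` is the base point. -/
def dualSet (P : ZMod e → ℤ) (q : Fin w → ℤ) (i : Fin w) : Finset (Fin w) :=
  Finset.univ.filter fun k => (q k : ZMod e) = q i ∧ (q i < P (q i) → q k ≤ q i) ∧
    (P (q i) < q i → q i ≤ q k)

theorem mem_dualSet {P : ZMod e → ℤ} {q : Fin w → ℤ} {i k : Fin w} :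
    k ∈ dualSet P q i ↔ (q k : ZMod e) = q i ∧ (q i < P (q i) → q k ≤ q i) ∧
      (P (q i) < q i → q i ≤ q k) := by
  simp [dualSet]

variable [NeZero e]

/-- The energy `∑_i ∑_r (q_i - P_r)⁺ + ∑_{i<k} (e + q_i - q_k)⁺` of a sequence of integers. No order
is imposed on `q`, so that this is a convex function on all of `ℤ^w`. -/
def energy (P : ZMod e → ℤ) (q : Fin w → ℤ) : ℤ :=
  ∑ i, ∑ r, max (q i - P r) 0 + ∑ i, ∑ k, if i < k then max (e + q i - q k) 0 else 0

/-- `x` is a subgradient of the energy at `q`, tested on integer displacements only. Equivalently,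
`q` maximizes `⟨x, q⟩ - energy P q` over `ℤ^w`. -/
def IsSubgradient (P : ZMod e → ℤ) (q : Fin w → ℤ) (x : Fin w → ℝ) : Prop :=
  ∀ v : Fin w → ℤ, ∑ i, x i * (v i : ℝ) ≤ ((energy P (q + v) - energy P q : ℤ) : ℝ)

/-- `q` is strictly increasing, and the values of `q` on any runner are an unbroken progression with
difference `e` running to the base point `P r` from either side; in particular they include `P r`
if the runner is not empty. -/
structure IsHookConfig (P : ZMod e → ℤ) (q : Fin w → ℤ) : Prop where
  strictMono : StrictMono q
  up : ∀ i, q i < P (q i) → ∃ k, q k = q i + e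
  down : ∀ i, P (q i) < q i → ∃ k, q k = q i - e

/-- The slope chosen for `(e + q_i - q_k)⁺`. At the kink `q_k = q_i + e` it is `1` from the base
point onwards and `0` before it. -/
def pairSlope (P : ZMod e → ℤ) (q : Fin w → ℤ) (i k : Fin w) : ℤ :=
  if i < k ∧ (q k < q i + e ∨ q k = q i + e ∧ P (q i) ≤ q i) then 1 else 0

/-- The gradient of the energy at `q` with the one-sided choices made in `pairSlope` and slope `0`
for `(q_i - P_r)⁺` at `q_i = P_r`. For a partition this is the label. -/
def slope (P : ZMod e → ℤ) (q : Fin w → ℤ) (i : Fin w) : ℤ :=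
  ∑ r, (if P r < q i then 1 else 0) + ∑ k, pairSlope P q i k - ∑ k, pairSlope P q k i

/-- `ε` is the family of modified basis vectors of `q`: the partner of `i` is the next value on its
runner in the direction of the base point. -/
def IsTightBasis (P : ZMod e → ℤ) (q : Fin w → ℤ) (ε : Fin w → Fin w → ℤ) : Prop :=
  ∀ i, (q i = P (q i) ∧ ε i = Pi.single i 1) ∨
    (q i < P (q i) ∧ ∃ k, q k = q i + e ∧ ε i = Pi.single i 1 - Pi.single k 1) ∨
    (P (q i) < q i ∧ ∃ k, q k = q i - e ∧ ε i = Pi.single i 1 - Pi.single k 1)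

/-- The expansion of the energy at a configuration: linear part given by the slope, and one kink for
each modified basis vector. The inequality is an equality as long as no other kink is crossed. -/
theorem energy_add_sub (P : ZMod e → ℤ) (hP : ∀ r, ((P r : ℤ) : ZMod e) = r) {q : Fin w → ℤ}
    (hq : IsHookConfig P q) {ε : Fin w → Fin w → ℤ} (hε : IsTightBasis P q ε) (v : Fin w → ℤ) :
    ∑ i, slope P q i * v i + ∑ i, max (∑ k, ε i k * v k) 0 ≤ energy P (q + v) - energy P q ∧
    ((∀ i, v i = 0 ∨ v i = 1) ∨ (∀ i, v i = 0 ∨ v i = -1) →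
      ∑ i, slope P q i * v i + ∑ i, max (∑ k, ε i k * v k) 0 = energy P (q + v) - energy P q) := by
  have hlt : ∀ i k, q k = q i + e → i < k := fun i k h => hq.strictMono.lt_iff_lt.1 (by
    have := NeZero.pos e
    omega)
  have hslope : ∑ i, slope P q i * v i =
      ∑ i, ∑ r, (if P r < q i then 1 else 0) * v i +
        ∑ i, ∑ k, pairSlope P q i k * (v i - v k) := by
    simp only [slope, add_mul, sub_mul, mul_sub, Finset.sum_mul, Finset.sum_add_distrib,
      Finset.sum_sub_distrib]
    rw [Finset.sum_comm (f := fun i k => pairSlope P q k i * v i)]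
    ring
  -- each active kink of the energy belongs to exactly one index `i`
  have hrem : ∑ i, max (∑ k, ε i k * v k) 0 =
      ∑ i, ∑ r, (if q i = P r then max (v i) 0 else 0) +
      ∑ i, ∑ k, ((if q k = q i + e ∧ q i < P (q i) then max (v i - v k) 0 else 0) +
        (if q k = q i + e ∧ P (q i) ≤ q i then max (v k - v i) 0 else 0)) := by
    simp only [Finset.sum_add_distrib]
    rw [Finset.sum_comm
      (f := fun i k => if q k = q i + e ∧ P (q i) ≤ q i then max (v k - v i) 0 else 0)]
    simp only [← Finset.sum_add_distrib]
    refine Finset.sum_congr rfl fun i _ => ?_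
    have hres : ∀ r, q i = P r → (q i : ZMod e) = r := fun r h => by rw [h, hP]
    have hcast : ∀ k, q i = q k + e → (q k : ZMod e) = q i := fun k hk => by
      rw [hk, intCast_add_self]
    have hpos := NeZero.pos e
    have hfirst : ∑ r, (if q i = P r then max (v i) 0 else 0) =
        if q i = P (q i) then max (v i) 0 else 0 := by
      rw [Finset.sum_eq_single (q i : ZMod e)]
      · exact fun r _ hr => if_neg fun h => hr ((hres r h).symm)
      · simp
    rw [hfirst]
    rcases hε i with ⟨h, h1⟩ | ⟨h, k, hk, h1⟩ | ⟨h, k, hk, h1⟩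
    · have e1 : ∀ x, ¬ (q x = q i + e ∧ q i < P (q i)) := fun x hx => by omega
      have e2 : ∀ x, ¬ (q i = q x + e ∧ P (q x) ≤ q x) := fun x hx => by
        rw [hcast x hx.1] at hx
        omega
      simp only [e1, e2, if_false, Finset.sum_const_zero, add_zero, h1, Pi.single_apply,
        ite_mul, one_mul, zero_mul, Finset.sum_ite_eq', Finset.mem_univ, if_true]
      rw [if_pos h]
    · have e1 : ∀ x, (q x = q i + e ∧ q i < P (q i)) ↔ x = k := fun x =>
        ⟨fun hx => hq.strictMono.injective (by omega), fun hx => by subst hx; exact ⟨hk, h⟩⟩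
      have e2 : ∀ x, ¬ (q i = q x + e ∧ P (q x) ≤ q x) := fun x hx => by
        rw [hcast x hx.1] at hx
        omega
      have e3 : ¬ (q i = P (q i)) := by omega
      simp only [e1, e2, e3, if_false, add_zero, h1,
        Pi.single_apply, Pi.sub_apply, sub_mul, Finset.sum_sub_distrib,
        ite_mul, one_mul, zero_mul, Finset.sum_ite_eq', Finset.mem_univ, if_true, zero_add]
    · have hki : (q k : ZMod e) = q i := by rw [hk, intCast_sub_self]
      have h3 : P (q i) ≤ q k := by
        have := add_le_of_lt_of_cast_eq h (hP _)
        omega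
      have e1 : ∀ x, ¬ (q x = q i + e ∧ q i < P (q i)) := fun x hx => by omega
      have e2 : ∀ x, (q i = q x + e ∧ P (q x) ≤ q x) ↔ x = k := fun x =>
        ⟨fun hx => hq.strictMono.injective (by omega),
          fun hx => by subst hx; exact ⟨by omega, by rw [hki]; exact h3⟩⟩
      have e3 : ¬ (q i = P (q i)) := by omega
      simp only [e1, e2, e3, if_false, h1,
        Pi.single_apply, Pi.sub_apply, sub_mul, Finset.sum_sub_distrib,
        ite_mul, one_mul, zero_mul, Finset.sum_ite_eq', Finset.mem_univ, if_true, zero_add]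
  have hE : energy P (q + v) - energy P q =
      ∑ i, ∑ r, (max (q i + v i - P r) 0 - max (q i - P r) 0) +
      ∑ i, ∑ k, if i < k then max (e + (q i + v i) - (q k + v k)) 0 - max (e + q i - q k) 0
        else 0 := by
    have : ∀ i k : Fin w, (if i < k then max (e + (q i + v i) - (q k + v k)) 0
          - max (e + q i - q k) 0 else 0) = (if i < k then max (e + (q i + v i) - (q k + v k)) 0
          else 0) - (if i < k then max (e + q i - q k) 0 else 0) := by
      intro i k
      split_ifs <;> simp
    simp only [this, Finset.sum_sub_distrib, energy, Pi.add_apply]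
    ring
  have hsplit : ∑ i, slope P q i * v i + ∑ i, max (∑ k, ε i k * v k) 0 =
      ∑ i, ∑ r, ((if P r < q i then 1 else 0) * v i + if q i = P r then max (v i) 0 else 0) +
      ∑ i, ∑ k, (pairSlope P q i k * (v i - v k) +
        ((if q k = q i + e ∧ q i < P (q i) then max (v i - v k) 0 else 0) +
        (if q k = q i + e ∧ P (q i) ≤ q i then max (v k - v i) 0 else 0))) := by
    rw [hslope, hrem]
    simp only [Finset.sum_add_distrib]
    ring
  rw [hsplit, hE]
  have ht1 : ∀ i r, (if P r < q i then 1 else 0) * v i + (if q i = P r then max (v i) 0 else 0) ≤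
        max (q i + v i - P r) 0 - max (q i - P r) 0 ∧
      ((v i = 0 ∨ v i = 1 ∨ v i = -1) →
        (if P r < q i then 1 else 0) * v i + (if q i = P r then max (v i) 0 else 0) =
        max (q i + v i - P r) 0 - max (q i - P r) 0) := by
    intro i r
    split_ifs <;> constructor <;> omega
  have ht2 : ∀ i k, pairSlope P q i k * (v i - v k) +
        ((if q k = q i + e ∧ q i < P (q i) then max (v i - v k) 0 else 0) +
        (if q k = q i + e ∧ P (q i) ≤ q i then max (v k - v i) 0 else 0)) ≤
        (if i < k then max (e + (q i + v i) - (q k + v k)) 0 - max (e + q i - q k) 0 else 0) ∧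
      ((v i - v k = 0 ∨ v i - v k = 1 ∨ v i - v k = -1) → pairSlope P q i k * (v i - v k) +
        ((if q k = q i + e ∧ q i < P (q i) then max (v i - v k) 0 else 0) +
        (if q k = q i + e ∧ P (q i) ≤ q i then max (v k - v i) 0 else 0)) =
        (if i < k then max (e + (q i + v i) - (q k + v k)) 0 - max (e + q i - q k) 0 else 0)) := by
    intro i k
    by_cases hik : i < k
    · simp only [pairSlope, hik, true_and, if_true]
      split_ifs <;> constructor <;> omega
    · have : q k ≠ q i + e := fun h => hik (hlt i k h)
      simp [pairSlope, hik, this]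
  constructor
  · exact add_le_add (Finset.sum_le_sum fun i _ => Finset.sum_le_sum fun r _ => (ht1 i r).1)
      (Finset.sum_le_sum fun i _ => Finset.sum_le_sum fun k _ => (ht2 i k).1)
  · intro hv
    congr 1
    · refine Finset.sum_congr rfl fun i _ => Finset.sum_congr rfl fun r _ => (ht1 i r).2 ?_
      rcases hv with hv | hv <;> have := hv i <;> omega
    · refine Finset.sum_congr rfl fun i _ => Finset.sum_congr rfl fun k _ => (ht2 i k).2 ?_
      rcases hv with hv | hv <;> have := hv i <;> have := hv k <;> omega

/-- The indicator vectors of the sets `dualSet P q i` are the dual basis of `ε`. -/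
theorem sum_dualSet_basis (P : ZMod e → ℤ) (hP : ∀ r, ((P r : ℤ) : ZMod e) = r)
    {q : Fin w → ℤ} (hq : IsHookConfig P q) {ε : Fin w → Fin w → ℤ} (hε : IsTightBasis P q ε)
    (i k : Fin w) : ∑ m ∈ dualSet P q i, ε k m = if k = i then 1 else 0 := by
  have hpos := NeZero.pos e
  have hsingle : ∀ a, ∑ m ∈ dualSet P q i, (Pi.single a 1 : Fin w → ℤ) m =
      if a ∈ dualSet P q i then 1 else 0 := fun a => by simp [Pi.single_apply]
  have hinj : ∀ a b, a = b ↔ q a = q b := fun a b => hq.strictMono.injective.eq_iff.symm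
  rcases hε k with ⟨h, h1⟩ | ⟨h, m, hm, h1⟩ | ⟨h, m, hm, h1⟩
  · simp only [h1, hsingle, mem_dualSet, hinj k i]
    refine if_congr ?_ rfl rfl
    constructor
    · rintro ⟨h2, h3, h4⟩
      rw [← h2] at h3 h4
      omega
    · intro h2
      rw [h2]
      exact ⟨rfl, fun _ => le_rfl, fun _ => le_rfl⟩
  · have hmk : (q m : ZMod e) = q k := by rw [hm, intCast_add_self]
    have h5 : q m ≤ P (q k) := by
      have := add_le_of_lt_of_cast_eq h (hP _).symm
      omega
    simp only [h1, Pi.sub_apply, Finset.sum_sub_distrib, hsingle, mem_dualSet, hmk,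
      hinj k i]
    by_cases hki : (q k : ZMod e) = q i
    · rw [hki] at h h5
      have := add_le_of_lt_of_cast_eq (e := e) (x := q k) (y := q i)
      have := add_le_of_lt_of_cast_eq (e := e) (x := q i) (y := q k)
      simp only [hki, true_and, forall_const] at *
      split_ifs <;> omega
    · have : q k ≠ q i := fun h => hki (by rw [h])
      simp [hki, this]
  · have hmk : (q m : ZMod e) = q k := by rw [hm, intCast_sub_self]
    have h5 : P (q k) ≤ q m := by
      have := add_le_of_lt_of_cast_eq h (hP _)
      omega
    simp only [h1, Pi.sub_apply, Finset.sum_sub_distrib, hsingle, mem_dualSet, hmk,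
      hinj k i]
    by_cases hki : (q k : ZMod e) = q i
    · rw [hki] at h h5
      have := add_le_of_lt_of_cast_eq (e := e) (x := q k) (y := q i)
      have := add_le_of_lt_of_cast_eq (e := e) (x := q i) (y := q k)
      simp only [hki, true_and, forall_const] at *
      split_ifs <;> omega
    · have : q k ≠ q i := fun h => hki (by rw [h])
      simp [hki, this]

/-- The coordinates of `x - z` in the basis `ε` are its sums over the dual sets. -/
theorem eq_add_sum_basis_iff (P : ZMod e → ℤ) (hP : ∀ r, ((P r : ℤ) : ZMod e) = r)
    {q : Fin w → ℤ} (hq : IsHookConfig P q) {ε : Fin w → Fin w → ℤ} (hε : IsTightBasis P q ε)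
    (z : Fin w → ℤ) (x a : Fin w → ℝ) :
    x = toReal z + ∑ i, a i • toReal (ε i) ↔
      ∀ i, a i = ∑ k ∈ dualSet P q i, (x k - z k) := by
  classical
  let A : Matrix (Fin w) (Fin w) ℝ := Matrix.of fun m k => (ε k m : ℝ)
  let B : Matrix (Fin w) (Fin w) ℝ := Matrix.of fun i m => if m ∈ dualSet P q i then 1 else 0
  have hBA : B * A = 1 := by
    ext i k
    have := congrArg (Int.cast : ℤ → ℝ) (sum_dualSet_basis P hP hq hε i k)
    simp only [Int.cast_sum] at this
    simp only [Matrix.mul_apply, Matrix.of_apply, A, B, ite_mul, one_mul, zero_mul,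
      Finset.sum_ite_mem, Finset.univ_inter, this, Matrix.one_apply, eq_comm (a := i)]
    split_ifs <;> simp
  have hAB : A * B = 1 := mul_eq_one_comm.1 hBA
  have h1 : (x = toReal z + ∑ i, a i • toReal (ε i)) ↔ A.mulVec a = x - toReal z := by
    rw [eq_comm, ← eq_sub_iff_add_eq']
    have : ∑ i, a i • toReal (ε i) = A.mulVec a := by
      ext m
      simp [A, Matrix.mulVec, dotProduct, toReal, Finset.sum_apply, mul_comm]
    rw [this]
  have h2 : (∀ i, a i = ∑ k ∈ dualSet P q i, (x k - z k)) ↔ a = B.mulVec (x - toReal z) := by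
    rw [funext_iff]
    refine forall_congr' fun i => ?_
    simp [B, Matrix.mulVec, dotProduct, toReal]
  rw [h1, h2]
  constructor
  · intro h
    rw [← h, Matrix.mulVec_mulVec, hBA, Matrix.one_mulVec]
  · intro h
    rw [h, Matrix.mulVec_mulVec, hAB, Matrix.one_mulVec]

/-- The subgradients at a configuration are the points whose coordinates in the parallelotope lie in
`[0, 1]`. -/
theorem isSubgradient_iff (P : ZMod e → ℤ) (hP : ∀ r, ((P r : ℤ) : ZMod e) = r)
    {q : Fin w → ℤ} (hq : IsHookConfig P q) {ε : Fin w → Fin w → ℤ} (hε : IsTightBasis P q ε)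
    (x : Fin w → ℝ) :
    IsSubgradient P q x ↔ ∀ i, 0 ≤ ∑ k ∈ dualSet P q i, (x k - slope P q k) ∧
      ∑ k ∈ dualSet P q i, (x k - slope P q k) ≤ 1 := by
  constructor
  · intro h i
    have hdual : ∀ s : ℤ, ∀ k, ∑ m, ε k m * (if m ∈ dualSet P q i then s else 0) =
        if k = i then s else 0 := by
      intro s k
      simp only [mul_ite, mul_zero, Finset.sum_ite_mem, Finset.univ_inter, ← Finset.sum_mul,
        sum_dualSet_basis P hP hq hε i k, ite_mul, one_mul, zero_mul]
    have key : ∀ s : ℤ, s = 1 ∨ s = -1 →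
        ∑ k ∈ dualSet P q i, (x k - slope P q k) * s ≤ ((max s 0 : ℤ) : ℝ) := by
      intro s hs
      have h1 := h fun k => if k ∈ dualSet P q i then s else 0
      -- the displacements `±1` on the dual set meet only the kink of `i`
      rw [← (energy_add_sub P hP hq hε fun k => if k ∈ dualSet P q i then s else 0).2 ?_] at h1
      · have h3 : ∀ k, max (if k = i then s else 0) 0 = if k = i then max s 0 else 0 := by
          intro k
          split_ifs <;> simp
        simp only [hdual, h3, Finset.sum_ite_eq', Finset.mem_univ, if_true] at h1
        push_cast [apply_ite (Int.cast : ℤ → ℝ)] at h1 ⊢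
        simp only [mul_ite, mul_zero, Finset.sum_ite_mem, Finset.univ_inter] at h1
        simp only [sub_mul, Finset.sum_sub_distrib]
        linarith
      · rcases hs with rfl | rfl
        · left
          intro k
          by_cases hk : k ∈ dualSet P q i <;> simp [hk]
        · right
          intro k
          by_cases hk : k ∈ dualSet P q i <;> simp [hk]
    have k1 := key 1 (Or.inl rfl)
    have k2 := key (-1) (Or.inr rfl)
    simp only [Int.cast_one, mul_one, Int.cast_neg, mul_neg, Finset.sum_neg_distrib] at k1 k2
    norm_num at k1 k2
    constructor <;> simp only [Finset.sum_sub_distrib] <;> linarith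
  · intro h v
    obtain ⟨a, ha⟩ : ∃ a : Fin w → ℝ, ∀ i, a i = ∑ k ∈ dualSet P q i, (x k - slope P q k) :=
      ⟨_, fun _ => rfl⟩
    have hx := (eq_add_sum_basis_iff P hP hq hε (slope P q) x a).2 ha
    simp only [← ha] at h
    have h1 : ((∑ i, slope P q i * v i + ∑ i, max (∑ k, ε i k * v k) 0 : ℤ) : ℝ) ≤
        ((energy P (q + v) - energy P q : ℤ) : ℝ) :=
      Int.cast_le.2 (energy_add_sub P hP hq hε v).1
    refine le_trans ?_ h1
    have h2 : ∑ i, x i * (v i : ℝ) = ∑ i, (slope P q i : ℝ) * v i +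
        ∑ i, a i * ∑ k, (ε i k : ℝ) * v k := by
      conv_lhs => rw [hx]
      simp only [Pi.add_apply, Finset.sum_apply, Pi.smul_apply, toReal, smul_eq_mul, add_mul,
        Finset.sum_add_distrib, Finset.sum_mul, Finset.mul_sum]
      rw [Finset.sum_comm]
      simp only [mul_assoc]
    rw [h2]
    push_cast
    gcongr with i
    obtain ⟨ha0, ha1⟩ := h i
    rcases le_total 0 (∑ k, (ε i k : ℝ) * v k) with h3 | h3
    · rw [max_eq_left h3]
      exact mul_le_of_le_one_left h3 ha1
    · rw [max_eq_right h3]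
      exact mul_nonpos_of_nonneg_of_nonpos ha0 h3

end Energy

/-! ### Maximizers of the tilted energy -/

section Maximizers

theorem monotone_of_consecutive {α : Type*} [Preorder α] {w : ℕ} {f : Fin w → α}
    (hf : ∀ i j : Fin w, (i : ℕ) + 1 = j → f i ≤ f j) : Monotone f := by
  intro i j hij
  obtain ⟨n, hn⟩ := Nat.exists_eq_add_of_le (Fin.le_def.1 hij)
  induction n generalizing j with
  | zero =>
    have : i = j := Fin.ext (by omega)
    rw [this]
  | succ n ih =>
    have hj := j.2
    exact (ih (j := ⟨i + n, by omega⟩) (Fin.le_def.2 (by simp)) rfl).trans (hf _ _ (by simp; omega))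

variable {e w : ℕ} [NeZero e]

theorem isSubgradient_iff_forall_le {P : ZMod e → ℤ} {q : Fin w → ℤ} {x : Fin w → ℝ} :
    IsSubgradient P q x ↔ ∀ q' : Fin w → ℤ,
      ∑ i, x i * (q' i : ℝ) - energy P q' ≤ ∑ i, x i * (q i : ℝ) - energy P q := by
  constructor
  · intro h q'
    have := h (q' - q)
    simp only [add_sub_cancel, Pi.sub_apply, Int.cast_sub, mul_sub, Finset.sum_sub_distrib] at this
    linarith
  · intro h v
    have := h (q + v)
    simp only [Pi.add_apply, Int.cast_add, mul_add, Finset.sum_add_distrib] at this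
    push_cast
    linarith

/-- Coercivity: the pair terms of the energy are nonnegative, and the base point terms alone have
slopes `0` and `e` at the two ends of every coordinate axis. -/
theorem finite_superlevel (P : ZMod e → ℤ) {x : Fin w → ℝ} (hx : ∀ i, 0 < x i ∧ x i < e) (c : ℝ) :
    {q : Fin w → ℤ | c ≤ ∑ i, x i * (q i : ℝ) - energy P q}.Finite := by
  set C : ℝ := ∑ r, |(P r : ℝ)| with hC
  set m : Fin w → ℝ := fun i => min (x i) (e - x i) with hm
  have hm0 : ∀ i, 0 < m i := fun i => lt_min (hx i).1 (by linarith [(hx i).2])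
  have hC0 : 0 ≤ C := Finset.sum_nonneg fun r _ => abs_nonneg _
  have hterm : ∀ (q : Fin w → ℤ) (i : Fin w),
      x i * (q i : ℝ) - ∑ r, ((max (q i - P r) 0 : ℤ) : ℝ) ≤ C - m i * |(q i : ℝ)| := by
    intro q i
    rcases le_total 0 (q i : ℝ) with h | h
    · rw [abs_of_nonneg h]
      have h1 : ∑ r : ZMod e, ((q i : ℝ) - |(P r : ℝ)|) ≤ ∑ r, ((max (q i - P r) 0 : ℤ) : ℝ) := by
        refine Finset.sum_le_sum fun r _ => ?_
        push_cast
        exact (sub_le_sub_left (le_abs_self _) _).trans (le_max_left _ _)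
      rw [Finset.sum_sub_distrib, Finset.sum_const, Finset.card_univ, ZMod.card,
        nsmul_eq_mul] at h1
      have h2 : m i * q i ≤ (e - x i) * q i := mul_le_mul_of_nonneg_right (min_le_right _ _) h
      linarith
    · rw [abs_of_nonpos h]
      have h1 : 0 ≤ ∑ r, ((max (q i - P r) 0 : ℤ) : ℝ) :=
        Finset.sum_nonneg fun r _ => Int.cast_nonneg (le_max_right _ _)
      have h2 : m i * -q i ≤ x i * -q i :=
        mul_le_mul_of_nonneg_right (min_le_left _ _) (by linarith)
      linarith
  have hbound : ∀ q : Fin w → ℤ, ∑ i, x i * (q i : ℝ) - energy P q ≤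
      ∑ i, (C - m i * |(q i : ℝ)|) := by
    intro q
    refine le_trans ?_ (Finset.sum_le_sum fun i _ => hterm q i)
    have h1 : 0 ≤ ∑ i : Fin w, ∑ k : Fin w, if i < k then max (e + q i - q k) 0 else 0 :=
      Finset.sum_nonneg fun i _ => Finset.sum_nonneg fun k _ => by split_ifs <;> simp
    have h2 : ∑ i, ∑ r, ((max (q i - P r) 0 : ℤ) : ℝ) ≤ energy P q := by
      rw [energy]
      exact_mod_cast le_add_of_nonneg_right h1
    rw [Finset.sum_sub_distrib]
    linarith
  refine (Set.finite_Icc (fun i => -⌈(w * C - c) / m i⌉) (fun i => ⌈(w * C - c) / m i⌉)).subset ?_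
  intro q hq
  have hq1 : ∀ i, |q i| ≤ ⌈(w * C - c) / m i⌉ := by
    intro i
    have h1 := le_trans (show c ≤ _ from hq) (hbound q)
    have h2 : m i * |(q i : ℝ)| ≤ ∑ i, m i * |(q i : ℝ)| :=
      Finset.single_le_sum (f := fun i => m i * |(q i : ℝ)|)
        (fun i _ => mul_nonneg (hm0 i).le (abs_nonneg _)) (Finset.mem_univ i)
    rw [Finset.sum_sub_distrib, Finset.sum_const, Finset.card_univ, Fintype.card_fin,
      nsmul_eq_mul] at h1
    have h3 : |(q i : ℝ)| ≤ (w * C - c) / m i := by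
      rw [le_div_iff₀ (hm0 i)]
      linarith
    have h4 := h3.trans (Int.le_ceil _)
    exact_mod_cast h4
  exact ⟨fun i => (abs_le.1 (hq1 i)).1, fun i => (abs_le.1 (hq1 i)).2⟩

/-- The tie-breaking by `∑ q_i²` selects a vertex among the maximizers. -/
theorem exists_extremal_subgradient (P : ZMod e → ℤ) {x : Fin w → ℝ}
    (hx : ∀ i, 0 < x i ∧ x i < e) :
    ∃ q : Fin w → ℤ, IsSubgradient P q x ∧
      ∀ q' : Fin w → ℤ, IsSubgradient P q' x → ∑ i, q' i ^ 2 ≤ ∑ i, q i ^ 2 := by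
  set G : (Fin w → ℤ) → ℝ := fun q => ∑ i, x i * (q i : ℝ) - energy P q with hG
  obtain ⟨q0, h0, h1⟩ := Set.exists_max_image _ G (finite_superlevel P hx (G 0)) ⟨0, le_refl (G 0)⟩
  have hq0 : IsSubgradient P q0 x := isSubgradient_iff_forall_le.2 fun q' => by
    rcases le_total (G 0) (G q') with h | h
    · exact h1 q' h
    · exact h.trans h0
  have hfin : {q : Fin w → ℤ | IsSubgradient P q x}.Finite :=
    (finite_superlevel P hx (G 0)).subset fun q hq => isSubgradient_iff_forall_le.1 hq 0
  exact Set.exists_max_image _ (fun q : Fin w → ℤ => ∑ i, q i ^ 2) hfin ⟨q0, hq0⟩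

/-- The first-order condition for raising the coordinate `k` by `1`. -/
theorem IsSubgradient.le_card {P : ZMod e → ℤ} {q : Fin w → ℤ} {x : Fin w → ℝ}
    (h : IsSubgradient P q x) (k : Fin w) :
    x k ≤ (((Finset.univ.filter fun r => P r ≤ q k).card +
      (Finset.univ.filter fun m => k < m ∧ q m ≤ q k + e).card -
      (Finset.univ.filter fun m => m < k ∧ q k < q m + e).card : ℤ) : ℝ) := by
  have h1 := h (Pi.single k 1)
  simp only [Pi.single_apply, apply_ite (Int.cast : ℤ → ℝ), Int.cast_one, Int.cast_zero, mul_ite,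
    mul_one, mul_zero, Finset.sum_ite_eq', Finset.mem_univ, if_true] at h1
  refine h1.trans (Int.cast_le.2 (le_of_eq ?_))
  have hP : ∀ i r, max (q i + (if i = k then 1 else 0) - P r) 0 = max (q i - P r) 0 +
      if i = k then (if P r ≤ q k then 1 else 0) else 0 := by
    intro i r
    by_cases hi : i = k
    · subst hi
      simp only [if_true]
      split_ifs <;> omega
    · simp [hi]
  have hW : ∀ i m, (if i < m then max (e + (q i + (if i = k then 1 else 0)) -
      (q m + (if m = k then 1 else 0))) 0 else 0) = (if i < m then max (e + q i - q m) 0 else 0) +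
      ((if i = k then (if k < m ∧ q m ≤ q k + e then 1 else 0) else 0) -
      (if m = k then (if i < k ∧ q k < q i + e then 1 else 0) else 0)) := by
    intro i m
    by_cases hi : i = k <;> by_cases hm : m = k
    · subst hi
      subst hm
      simp
    · subst hi
      simp only [if_true, hm, if_false]
      by_cases hlt : i < m
      · simp only [hlt, true_and, if_true]
        split_ifs <;> omega
      · simp [hlt]
    · subst hm
      simp only [if_true, hi, if_false]
      by_cases hlt : i < m
      · simp only [hlt, true_and, if_true]
        split_ifs <;> omega
      · simp [hlt]
    · simp [hi, hm]
  simp only [energy, Pi.add_apply, Pi.single_apply, hP, hW, Finset.sum_add_distrib,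
    Finset.sum_sub_distrib, Finset.natCast_card_filter]
  rw [Finset.sum_comm (f := fun i r => if i = k then (if P r ≤ q k then (1 : ℤ) else 0) else 0),
    Finset.sum_comm (f := fun i m => if i = k then
      (if k < m ∧ q m ≤ q k + e then (1 : ℤ) else 0) else 0)]
  simp only [Finset.sum_ite_eq', Finset.mem_univ, if_true]
  ring

/-- The first-order condition for lowering the coordinate `k` by `1`. -/
theorem IsSubgradient.card_le {P : ZMod e → ℤ} {q : Fin w → ℤ} {x : Fin w → ℝ}
    (h : IsSubgradient P q x) (k : Fin w) :
    (((Finset.univ.filter fun r => P r < q k).card +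
      (Finset.univ.filter fun m => k < m ∧ q m < q k + e).card -
      (Finset.univ.filter fun m => m < k ∧ q k ≤ q m + e).card : ℤ) : ℝ) ≤ x k := by
  have h1 := h (Pi.single k (-1))
  simp only [Pi.single_apply, apply_ite (Int.cast : ℤ → ℝ), Int.cast_neg, Int.cast_one,
    Int.cast_zero, mul_ite,
    mul_neg, mul_one, mul_zero, Finset.sum_ite_eq', Finset.mem_univ, if_true] at h1
  rw [neg_le, ← Int.cast_neg] at h1
  refine le_trans (Int.cast_le.2 (le_of_eq ?_)) h1
  have hP : ∀ i r, max (q i + (if i = k then -1 else 0) - P r) 0 = max (q i - P r) 0 -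
      if i = k then (if P r < q k then 1 else 0) else 0 := by
    intro i r
    by_cases hi : i = k
    · subst hi
      simp only [if_true]
      split_ifs <;> omega
    · simp [hi]
  have hW : ∀ i m, (if i < m then max (e + (q i + (if i = k then -1 else 0)) -
      (q m + (if m = k then -1 else 0))) 0 else 0) = (if i < m then max (e + q i - q m) 0 else 0) -
      ((if i = k then (if k < m ∧ q m < q k + e then 1 else 0) else 0) -
      (if m = k then (if i < k ∧ q k ≤ q i + e then 1 else 0) else 0)) := by
    intro i m
    by_cases hi : i = k <;> by_cases hm : m = k
    · subst hi
      subst hm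
      simp
    · subst hi
      simp only [if_true, hm, if_false]
      by_cases hlt : i < m
      · simp only [hlt, true_and, if_true]
        split_ifs <;> omega
      · simp [hlt]
    · subst hm
      simp only [if_true, hi, if_false]
      by_cases hlt : i < m
      · simp only [hlt, true_and, if_true]
        split_ifs <;> omega
      · simp [hlt]
    · simp [hi, hm]
  simp only [energy, Pi.add_apply, Pi.single_apply, hP, hW,
    Finset.sum_sub_distrib, Finset.natCast_card_filter]
  rw [Finset.sum_comm (f := fun i r => if i = k then (if P r < q k then (1 : ℤ) else 0) else 0),
    Finset.sum_comm (f := fun i m => if i = k then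
      (if k < m ∧ q m < q k + e then (1 : ℤ) else 0) else 0)]
  simp only [Finset.sum_ite_eq', Finset.mem_univ, if_true]
  ring

theorem IsSubgradient.nonneg_of_isBot {P : ZMod e → ℤ} {q : Fin w → ℤ} {x : Fin w → ℝ}
    (h : IsSubgradient P q x) {k : Fin w} (hk : IsBot k) : 0 ≤ x k := by
  refine le_trans ?_ (h.card_le k)
  rw [Finset.filter_false_of_mem (p := fun m => m < k ∧ q k ≤ q m + e)
    fun m _ hm => (hk m).not_gt hm.1]
  exact Int.cast_nonneg (by simp; omega)

theorem IsSubgradient.le_of_isTop {P : ZMod e → ℤ} {q : Fin w → ℤ} {x : Fin w → ℝ}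
    (h : IsSubgradient P q x) {k : Fin w} (hk : IsTop k) : x k ≤ e := by
  refine (h.le_card k).trans ?_
  rw [Finset.filter_false_of_mem (p := fun m => k < m ∧ q m ≤ q k + e)
    fun m _ hm => (hk m).not_gt hm.1]
  have := Finset.card_filter_le (Finset.univ : Finset (ZMod e)) fun r => P r ≤ q k
  rw [Finset.card_univ, ZMod.card] at this
  rw [← Int.cast_natCast (R := ℝ) e]
  exact Int.cast_le.2 (by simp; omega)

theorem IsSubgradient.monotone {P : ZMod e → ℤ} {q : Fin w → ℤ} {x : Fin w → ℝ}
    (h : IsSubgradient P q x) (hx : ∀ i j : Fin w, (i : ℕ) + 1 = j → 3 < x j - x i) :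
    Monotone q := by
  refine monotone_of_consecutive fun i k hik => ?_
  by_contra! hlt
  have h1 := h.le_card k
  have h2 := h.card_le i
  have c1 : (Finset.univ.filter fun r => P r ≤ q k).card ≤
      (Finset.univ.filter fun r => P r < q i).card :=
    Finset.card_le_card (Finset.monotone_filter_right _ fun r _ hr => lt_of_le_of_lt hr hlt)
  have c2 : (Finset.univ.filter fun m => k < m ∧ q m ≤ q k + e).card ≤
      (Finset.univ.filter fun m => i < m ∧ q m < q i + e).card :=
    Finset.card_le_card (Finset.monotone_filter_right _ fun m _ hm => by
      have := Fin.lt_def.1 hm.1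
      exact ⟨Fin.lt_def.2 (by omega), by omega⟩)
  have c3 : (Finset.univ.filter fun m => m < i ∧ q i ≤ q m + e).card ≤
      (Finset.univ.filter fun m => m < k ∧ q k < q m + e).card :=
    Finset.card_le_card (Finset.monotone_filter_right _ fun m _ hm => by
      have := Fin.lt_def.1 hm.1
      exact ⟨Fin.lt_def.2 (by omega), by omega⟩)
  have h3 := hx i k hik
  have h4 := h1.trans (Int.cast_le.2 (show _ ≤ _ by omega : _ ≤ (((Finset.univ.filter fun r =>
    P r < q i).card + (Finset.univ.filter fun m => i < m ∧ q m < q i + e).card -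
      (Finset.univ.filter fun m => m < i ∧ q i ≤ q m + e).card : ℤ))))
  linarith

/-- Compare raising the last with lowering the first of a longest block of equal coordinates
`q_i = … = q_k`: the three differences of counts are at most `1` each, so that `x_k - x_i ≤ 3`. -/
theorem IsSubgradient.strictMono {P : ZMod e → ℤ} (hP : ∀ r, ((P r : ℤ) : ZMod e) = r)
    {q : Fin w → ℤ} {x : Fin w → ℝ}
    (h : IsSubgradient P q x) (hx : ∀ i j : Fin w, (i : ℕ) + 1 = j → 3 < x j - x i) :
    StrictMono q := by
  have hmono := h.monotone hx
  have hxmono : Monotone x := monotone_of_consecutive fun i j hij => by linarith [hx i j hij]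
  refine hmono.strictMono_of_injective ?_
  by_contra hinj
  obtain ⟨a, b, hab, hne⟩ : ∃ a b, q a = q b ∧ a < b := by
    rw [Function.Injective] at hinj
    push Not at hinj
    obtain ⟨a, b, hab, hne⟩ := hinj
    rcases lt_or_gt_of_ne hne with h | h
    exacts [⟨a, b, hab, h⟩, ⟨b, a, hab.symm, h⟩]
  obtain ⟨⟨i, k⟩, hik, hmax⟩ := Finset.exists_max_image
    (Finset.univ.filter fun p : Fin w × Fin w => q p.1 = q p.2 ∧ p.1 < p.2)
    (fun p => (p.2 : ℕ) - (p.1 : ℕ)) ⟨(a, b), by simp [hab, hne]⟩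
  simp only [Finset.mem_filter, Finset.mem_univ, true_and, Prod.forall] at hik hmax
  obtain ⟨hq, hlt⟩ := hik
  have hlt' := Fin.lt_def.1 hlt
  have hpos := NeZero.pos e
  -- no value is taken more often than the one of the longest block
  have hcard : ∀ c : ℤ, (Finset.univ.filter fun m => q m = c).card ≤ (k : ℕ) - i + 1 := by
    intro c
    rcases (Finset.univ.filter fun m => q m = c).eq_empty_or_nonempty with h0 | h0
    · simp [h0]
    · set s := Finset.univ.filter fun m => q m = c
      have h1 : s ⊆ Finset.Icc (s.min' h0) (s.max' h0) := fun m hm =>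
        Finset.mem_Icc.2 ⟨Finset.min'_le _ _ hm, Finset.le_max' _ _ hm⟩
      have h2 := Finset.card_le_card h1
      rw [Fin.card_Icc] at h2
      have h3 : q (s.min' h0) = c := (Finset.mem_filter.1 (Finset.min'_mem s h0)).2
      have h4 : q (s.max' h0) = c := (Finset.mem_filter.1 (Finset.max'_mem s h0)).2
      have h5 := hmax (s.min' h0) (s.max' h0)
      rcases lt_or_ge (s.min' h0) (s.max' h0) with h6 | h6
      · have := h5 ⟨h3.trans h4.symm, h6⟩
        have := Fin.lt_def.1 h6
        omega
      · have := Fin.le_def.1 h6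
        omega
  have c1 : (Finset.univ.filter fun r => P r ≤ q k).card ≤
      (Finset.univ.filter fun r => P r < q i).card + 1 := by
    refine le_trans (Finset.card_le_card (fun r hr => ?_)) (Finset.card_insert_le (q k : ZMod e) _)
    simp only [Finset.mem_filter, Finset.mem_univ, true_and, Finset.mem_insert] at hr ⊢
    rcases hr.lt_or_eq with h1 | h1
    · exact Or.inr (by omega)
    · exact Or.inl (by rw [← h1, hP])
  have c2 : (Finset.univ.filter fun m => k < m ∧ q m ≤ q k + e).card + (Finset.Ioc i k).card ≤
      (Finset.univ.filter fun m => i < m ∧ q m < q i + e).card +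
      (Finset.univ.filter fun m => q m = q k + e).card := by
    rw [← Finset.card_union_of_disjoint]
    · refine le_trans (Finset.card_le_card fun m hm => ?_) (Finset.card_union_le _ _)
      simp only [Finset.mem_union, Finset.mem_filter, Finset.mem_univ, true_and,
        Finset.mem_Ioc] at hm ⊢
      rcases hm with ⟨h1, h2⟩ | ⟨h1, h2⟩
      · rcases h2.lt_or_eq with h3 | h3
        · exact Or.inl ⟨hlt.trans h1, by omega⟩
        · exact Or.inr h3
      · have := hmono h2
        exact Or.inl ⟨h1, by omega⟩
    · refine Finset.disjoint_left.2 fun m h1 h2 => ?_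
      exact (Finset.mem_Ioc.1 h2).2.not_gt (Finset.mem_filter.1 h1).2.1
  have c3 : (Finset.univ.filter fun m => m < i ∧ q i ≤ q m + e).card + (Finset.Ico i k).card ≤
      (Finset.univ.filter fun m => m < k ∧ q k < q m + e).card +
      (Finset.univ.filter fun m => q m = q k - e).card := by
    rw [← Finset.card_union_of_disjoint]
    · refine le_trans (Finset.card_le_card fun m hm => ?_) (Finset.card_union_le _ _)
      simp only [Finset.mem_union, Finset.mem_filter, Finset.mem_univ, true_and,
        Finset.mem_Ico] at hm ⊢
      rcases hm with ⟨h1, h2⟩ | ⟨h1, h2⟩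
      · rcases h2.lt_or_eq with h3 | h3
        · exact Or.inl ⟨h1.trans hlt, by omega⟩
        · exact Or.inr (by omega)
      · have := hmono h1
        exact Or.inl ⟨h2, by omega⟩
    · refine Finset.disjoint_left.2 fun m h1 h2 => ?_
      exact (Finset.mem_Ico.1 h2).1.not_gt (Finset.mem_filter.1 h1).2.1
  rw [Fin.card_Ioc] at c2
  rw [Fin.card_Ico] at c3
  have c4 := hcard (q k + e)
  have c5 := hcard (q k - e)
  have h1 := h.le_card k
  have h2 := h.card_le i
  have h3 : 3 < x k - x i := by
    have hk := k.2
    have h5 := hx i ⟨i + 1, by omega⟩ rfl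
    have h6 : x ⟨i + 1, by omega⟩ ≤ x k := hxmono (Fin.le_def.2 hlt')
    linarith
  have h4 : x k - x i ≤ ((3 : ℤ) : ℝ) := by
    refine (sub_le_sub h1 h2).trans ?_
    rw [← Int.cast_sub]
    exact Int.cast_le.2 (by omega)
  norm_num at h4
  linarith

/-- Moving a set `C` of coordinates by `1` or `-1` changes the energy linearly if no kink is active
between `C` and the base points or the other coordinates. Then both moves lead to maximizers, and
one of them has a larger sum of squares unless `C` is empty. -/
theorem shiftable_eq_empty {P : ZMod e → ℤ} {q : Fin w → ℤ} {x : Fin w → ℝ}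
    (h : IsSubgradient P q x)
    (hmax : ∀ q' : Fin w → ℤ, IsSubgradient P q' x → ∑ i, q' i ^ 2 ≤ ∑ i, q i ^ 2)
    (C : Finset (Fin w)) (hC : ∀ i ∈ C, ∀ r, q i ≠ P r)
    (hlink : ∀ i k, q k = q i + e → (i ∈ C ↔ k ∈ C)) : C = ∅ := by
  set u : Fin w → ℤ := fun i => if i ∈ C then 1 else 0 with hu
  have hE : energy P (q + u) + energy P (q + -u) = energy P q + energy P q := by
    have e1 : ∀ i r, max (q i + u i - P r) 0 + max (q i + -u i - P r) 0 =
        max (q i - P r) 0 + max (q i - P r) 0 := by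
      intro i r
      by_cases hi : i ∈ C
      · have := hC i hi r
        simp only [hu, hi, if_true]
        omega
      · simp [hu, hi]
    have e2 : ∀ i k : Fin w, (if i < k then max (e + (q i + u i) - (q k + u k)) 0 else 0) +
        (if i < k then max (e + (q i + -u i) - (q k + -u k)) 0 else 0) =
        (if i < k then max (e + q i - q k) 0 else 0) +
        (if i < k then max (e + q i - q k) 0 else 0) := by
      intro i k
      have hl := hlink i k
      by_cases hi : i ∈ C <;> by_cases hk : k ∈ C <;>
        simp only [hi, hk, iff_true, iff_false, not_true, imp_false] at hl <;>
        simp only [hu, hi, hk, if_true, if_false] <;> split_ifs <;> omega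
    simp only [energy, Pi.add_apply, Pi.neg_apply]
    rw [add_add_add_comm, add_add_add_comm (∑ i, ∑ r, max (q i - P r) 0)]
    simp only [← Finset.sum_add_distrib, e1, e2]
  have hstep : ∀ v : Fin w → ℤ, energy P (q + v) + energy P (q + -v) = energy P q + energy P q →
      IsSubgradient P (q + v) x := by
    intro v hv v'
    have h1 := h (v + v')
    have h2 := h (-v)
    rw [← add_assoc] at h1
    simp only [Pi.add_apply, Pi.neg_apply, Int.cast_add, Int.cast_neg, mul_add, mul_neg,
      Finset.sum_add_distrib, Finset.sum_neg_distrib] at h1 h2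
    have h3 := congrArg (Int.cast : ℤ → ℝ) hv
    push_cast at h1 h2 h3 ⊢
    linarith
  have m1 := hmax _ (hstep u hE)
  have m2 := hmax _ (hstep (-u) (by rw [neg_neg, add_comm, hE]))
  have m3 : ∑ i, (q + u) i ^ 2 + ∑ i, (q + -u) i ^ 2 =
      ∑ i, q i ^ 2 + ∑ i, q i ^ 2 + 2 * C.card := by
    have e1 : ∀ i, (q + u) i ^ 2 + (q + -u) i ^ 2 =
        q i ^ 2 + q i ^ 2 + 2 * if i ∈ C then 1 else 0 := by
      intro i
      by_cases hi : i ∈ C <;> simp [hu, hi]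
      ring
    rw [← Finset.sum_add_distrib, Finset.sum_congr rfl fun i _ => e1 i, Finset.sum_add_distrib,
      Finset.sum_add_distrib, ← Finset.mul_sum]
    simp
  exact Finset.card_eq_zero.1 (by omega)

theorem exists_hookConfig (P : ZMod e → ℤ) (hP : ∀ r, ((P r : ℤ) : ZMod e) = r) {x : Fin w → ℝ}
    (hx : ∀ i, 0 < x i ∧ x i < e)
    (hx' : ∀ i j : Fin w, (i : ℕ) + 1 = j → 3 < x j - x i) :
    ∃ q : Fin w → ℤ, IsHookConfig P q ∧ IsSubgradient P q x := by
  obtain ⟨q, h, hmax⟩ := exists_extremal_subgradient P hx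
  have hPne : ∀ i k : Fin w, (q k : ZMod e) = q i → q k ≠ P (q i) → ∀ r, q k ≠ P r := by
    intro i k h1 h2 r h3
    have : r = q k := by rw [h3, hP]
    exact h2 (by rw [h3, this, h1])
  have hmod : ∀ a b : ℤ, b = a + e → (a : ZMod e) = b := fun a b hab => by
    rw [hab, intCast_add_self]
  refine ⟨q, ⟨h.strictMono hP hx', fun i hi => ?_, fun i hi => ?_⟩, h⟩
  · by_contra! hne
    have := shiftable_eq_empty h hmax
      (Finset.univ.filter fun k => (q k : ZMod e) = q i ∧ q k ≤ q i) ?_ ?_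
    · exact Finset.notMem_empty i (this ▸ by simp)
    · intro k hk
      simp only [Finset.mem_filter, Finset.mem_univ, true_and] at hk
      exact hPne i k hk.1 (by omega)
    · intro a b hab
      simp only [Finset.mem_filter, Finset.mem_univ, true_and, hmod _ _ hab]
      refine and_congr_right fun h1 => ⟨fun h2 => ?_, fun h2 => by omega⟩
      have h3 : q a ≠ q i := fun h3 => hne b (by omega)
      have := add_le_of_lt_of_cast_eq (lt_of_le_of_ne h2 h3) ((hmod _ _ hab).trans h1)
      omega
  · by_contra! hne
    have := shiftable_eq_empty h hmax
      (Finset.univ.filter fun k => (q k : ZMod e) = q i ∧ q i ≤ q k) ?_ ?_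
    · exact Finset.notMem_empty i (this ▸ by simp)
    · intro k hk
      simp only [Finset.mem_filter, Finset.mem_univ, true_and] at hk
      exact hPne i k hk.1 (by omega)
    · intro a b hab
      simp only [Finset.mem_filter, Finset.mem_univ, true_and, hmod _ _ hab]
      refine and_congr_right fun h1 => ⟨fun h2 => by omega, fun h2 => ?_⟩
      have h3 : q b ≠ q i := fun h3 => hne a (by omega)
      have := add_le_of_lt_of_cast_eq (lt_of_le_of_ne h2 (Ne.symm h3)) h1.symm
      omega

/-- A value farther than `w * e` from the base point of its runner would need more than `w` values
on the way there. -/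
theorem finite_hookConfig (P : ZMod e → ℤ) :
    {q : Fin w → ℤ | IsHookConfig P q}.Finite := by
  have key : ∀ (q : Fin w → ℤ), Function.Injective q → ∀ (i : Fin w) (s : ℤ), s ≠ 0 →
      ¬ ∀ n : ℕ, n ≤ w → ∃ k, q k = q i + n * s := by
    intro q hq i s hs h
    choose f hf using fun n : Fin (w + 1) => h n (Nat.lt_succ_iff.1 n.2)
    have : Function.Injective f := by
      intro a b hab
      have h1 := (hf a).symm.trans ((congrArg q hab).trans (hf b))
      have h2 : ((a : ℕ) : ℤ) * s = (b : ℕ) * s := by linarith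
      exact Fin.ext (by exact_mod_cast mul_right_cancel₀ hs h2)
    have := Fintype.card_le_of_injective f this
    simp at this
  obtain ⟨M, hM⟩ : ∃ M : ℤ, ∀ r, |P r| ≤ M := by
    obtain ⟨M, hM⟩ := (Set.finite_range fun r => |P r|).bddAbove
    exact ⟨M, fun r => hM ⟨r, rfl⟩⟩
  have hpos := NeZero.pos e
  refine (Set.finite_Icc (fun _ => -M - w * e) (fun _ => M + w * e)).subset ?_
  intro q hq
  have hq : IsHookConfig P q := hq
  constructor
  · intro i
    by_contra! hlt
    refine key q hq.strictMono.injective i e (by omega) fun n hn => ?_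
    induction n with
    | zero => exact ⟨i, by simp⟩
    | succ n ih =>
      obtain ⟨k, hk⟩ := ih (by omega)
      have h1 := abs_le.1 (hM (q k))
      have h2 : (n : ℤ) * e ≤ w * e :=
        mul_le_mul_of_nonneg_right (by omega) (by omega)
      obtain ⟨m, hm⟩ := hq.up k (by dsimp only at hlt; omega)
      exact ⟨m, by rw [hm, hk]; push_cast; ring⟩
  · intro i
    by_contra! hlt
    refine key q hq.strictMono.injective i (-e) (by omega) fun n hn => ?_
    induction n with
    | zero => exact ⟨i, by simp⟩
    | succ n ih =>
      obtain ⟨k, hk⟩ := ih (by omega)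
      have h1 := abs_le.1 (hM (q k))
      have h2 : (n : ℤ) * e ≤ w * e :=
        mul_le_mul_of_nonneg_right (by omega) (by omega)
      rw [mul_neg] at hk
      obtain ⟨m, hm⟩ := hq.down k (by dsimp only at hlt; omega)
      exact ⟨m, by rw [hm, hk]; push_cast; ring⟩

end Maximizers

/-! ### Partitions and their beta-numbers -/

section BetaNumbers

theorem strictMono_neg_beta (lam : YoungDiagram) :
    StrictMono fun i : ℕ => -((lam.rowLen i : ℤ) - ((i : ℤ) + 1)) := by
  intro i j hij
  have := lam.rowLen_anti i j hij.le
  dsimp only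
  omega

theorem beta_injective : Function.Injective beta := by
  intro lam mu h
  have h1 : Set.range (fun i : ℕ => -((lam.rowLen i : ℤ) - ((i : ℤ) + 1))) =
      Set.range (fun i : ℕ => -((mu.rowLen i : ℤ) - ((i : ℤ) + 1))) := by
    have := congrArg (fun S : Set ℤ => Neg.neg '' S) h
    simpa only [beta, ← Set.range_comp, Function.comp_def] using this
  have h2 := ((strictMono_neg_beta lam).range_inj (strictMono_neg_beta mu)).1 h1
  ext ⟨i, j⟩
  have h3 := congrFun h2 i
  rw [YoungDiagram.mem_cells, YoungDiagram.mem_cells, YoungDiagram.mem_iff_lt_rowLen,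
    YoungDiagram.mem_iff_lt_rowLen]
  omega

theorem ofRowLens_rowLen_of_le {l : List ℕ} {hl : l.SortedGE} {i : ℕ} (hi : l.length ≤ i) :
    (YoungDiagram.ofRowLens l hl).rowLen i = 0 := by
  by_contra h
  obtain ⟨h1, -⟩ := YoungDiagram.mem_ofRowLens.1
    (YoungDiagram.mem_iff_lt_rowLen.2 (Nat.pos_of_ne_zero h))
  exact absurd h1 (not_lt.2 hi)

/-- Every set that contains all `x < -n` and exactly `n` integers `≥ -n` is the set of beta-numbers
of a partition. -/
theorem exists_beta_eq (s : Finset ℤ) (hs : ∀ x ∈ s, -(s.card : ℤ) ≤ x) :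
    ∃ lam : YoungDiagram, ∀ x, x ∈ beta lam ↔ x < -(s.card : ℤ) ∨ x ∈ s := by
  obtain ⟨n, hn⟩ : ∃ n, s.card = n := ⟨_, rfl⟩
  rw [hn] at hs ⊢
  set t := s.orderEmbOfFin hn with ht
  have hmono : Monotone fun i : Fin n => t i - (i : ℤ) := monotone_of_consecutive fun i j hij => by
    have : t i < t j := t.strictMono (Fin.lt_def.2 (by omega))
    omega
  have hlow : ∀ i : Fin n, -(n : ℤ) + i ≤ t i := by
    intro i
    have h1 := hmono (Fin.le_def.2 (Nat.zero_le i) : (⟨0, i.pos⟩ : Fin n) ≤ i)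
    have h2 := hs _ (s.orderEmbOfFin_mem hn ⟨0, i.pos⟩)
    rw [← ht] at h2
    simp only [Nat.cast_zero] at h1
    omega
  let l : List ℕ := List.ofFn fun i : Fin n => (t i.rev + (i + 1)).toNat
  have hlen : l.length = n := List.length_ofFn
  have hl : l.SortedGE := by
    refine List.Pairwise.sortedGE ?_
    rw [List.pairwise_ofFn]
    intro i j hij
    have h1 := hmono (Fin.rev_le_rev.2 hij.le)
    simp only [Fin.val_rev] at h1
    have := i.2
    have := j.2
    show (t j.rev + (j + 1)).toNat ≤ (t i.rev + (i + 1)).toNat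
    omega
  have hrow : ∀ i : Fin n, ((YoungDiagram.ofRowLens l hl).rowLen i : ℤ) - ((i : ℤ) + 1) =
      t i.rev := by
    intro i
    have h1 := YoungDiagram.rowLen_ofRowLens (hw := hl) ⟨i, by rw [hlen]; exact i.2⟩
    have h2 := hlow i.rev
    have := i.2
    rw [Fin.val_rev] at h2
    simp only [l, Fin.getElem_fin, List.getElem_ofFn] at h1
    simp only [l]
    rw [h1]
    simp only [Fin.eta]
    omega
  refine ⟨YoungDiagram.ofRowLens l hl, fun x => ⟨?_, ?_⟩⟩
  · rintro ⟨i, rfl⟩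
    rcases lt_or_ge i n with hi | hi
    · right
      have := hrow ⟨i, hi⟩
      simp only at this
      dsimp only
      rw [this]
      exact s.orderEmbOfFin_mem hn _
    · left
      dsimp only
      rw [ofRowLens_rowLen_of_le (by omega)]
      omega
  · rintro (hx | hx)
    · refine ⟨(-x - 1).toNat, ?_⟩
      dsimp only
      rw [ofRowLens_rowLen_of_le (by omega)]
      omega
    · rw [← Finset.mem_coe, ← Finset.range_orderEmbOfFin s hn] at hx
      obtain ⟨i, rfl⟩ := hx
      refine ⟨i.rev, ?_⟩
      have := hrow i.rev
      rw [Fin.rev_rev] at this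
      exact this

theorem card_beta_Ici (lam : YoungDiagram) (n : ℕ) (hn : lam.colLen 0 ≤ n) :
    ∃ s : Finset ℤ, s.card = n ∧ ∀ x, x ∈ s ↔ x ∈ beta lam ∧ -(n : ℤ) ≤ x := by
  refine ⟨(Finset.range n).image fun i : ℕ => (lam.rowLen i : ℤ) - ((i : ℤ) + 1), ?_, ?_⟩
  · rw [Finset.card_image_of_injective, Finset.card_range]
    intro i j hij
    exact (strictMono_neg_beta lam).injective (congrArg Neg.neg hij)
  · intro x
    simp only [Finset.mem_image, Finset.mem_range]
    constructor
    · rintro ⟨i, hi, rfl⟩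
      exact ⟨⟨i, rfl⟩, by omega⟩
    · rintro ⟨⟨i, rfl⟩, hi⟩
      refine ⟨i, ?_, rfl⟩
      by_contra! hni
      have h0 : lam.rowLen i = 0 := by
        by_contra h0
        have := YoungDiagram.mem_iff_lt_colLen.1
          (YoungDiagram.mem_iff_lt_rowLen.2 (Nat.pos_of_ne_zero h0))
        omega
      dsimp only at hi
      omega

/-- Moving finitely many beads to distinct positions gives the beta-numbers of another partition. -/
theorem exists_beta_eq_image (kap : YoungDiagram) (f : ℤ → ℤ) (hf : Set.InjOn f (beta kap))
    (hfin : ∃ n : ℕ, ∀ x, (f x ≠ x → -(n : ℤ) ≤ x ∧ -(n : ℤ) ≤ f x)) :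
    ∃ lam : YoungDiagram, beta lam = f '' beta kap := by
  obtain ⟨n, hn⟩ := hfin
  obtain ⟨s, hs, hmem⟩ := card_beta_Ici kap (max n (kap.colLen 0)) (le_max_right _ _)
  set N := max n (kap.colLen 0)
  have hnN : n ≤ N := le_max_left _ _
  have hcN : kap.colLen 0 ≤ N := le_max_right _ _
  have hcard : (s.image f).card = N := by
    rw [Finset.card_image_of_injOn, hs]
    exact fun x hx y hy h => hf ((hmem x).1 hx).1 ((hmem y).1 hy).1 h
  obtain ⟨lam, hlam⟩ := exists_beta_eq (s.image f) (by
    intro x hx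
    rw [hcard]
    obtain ⟨y, hy, rfl⟩ := Finset.mem_image.1 hx
    have := ((hmem y).1 hy).2
    by_cases h : f y = y
    · rwa [h]
    · have := (hn y h).2
      omega)
  refine ⟨lam, Set.ext fun x => ?_⟩
  rw [hlam, hcard]
  constructor
  · rintro (hx | hx)
    · refine ⟨x, mem_beta_of_lt kap x (by omega), ?_⟩
      by_contra h
      have := (hn x h).1
      omega
    · obtain ⟨y, hy, rfl⟩ := Finset.mem_image.1 hx
      exact ⟨y, ((hmem y).1 hy).1, rfl⟩
  · rintro ⟨y, hy, rfl⟩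
    by_cases h : -(N : ℤ) ≤ y
    · exact Or.inr (Finset.mem_image_of_mem f ((hmem y).2 ⟨hy, h⟩))
    · left
      by_cases h' : f y = y
      · omega
      · have := (hn y h').1
        omega

end BetaNumbers

/-! ### The abacus of a hook-quotient partition -/

section Abacus

/-- Runner `r` of the abacus of `lam` arises from the beads below `P r` by moving the bead at `g r`
to `T r`. A runner on which nothing moves is encoded by `T r = g r = P r - e`. -/
structure IsHookAbacus {e : ℕ} (P g T : ZMod e → ℤ) (lam : YoungDiagram) : Prop where
  base_cast : ∀ r, ((P r : ℤ) : ZMod e) = r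
  gap_cast : ∀ r, ((g r : ℤ) : ZMod e) = r
  top_cast : ∀ r, ((T r : ℤ) : ZMod e) = r
  gap_add_le : ∀ r, g r + e ≤ P r
  top_cases : ∀ r, P r ≤ T r ∨ T r = g r ∧ g r + e = P r
  mem_beta : ∀ (r : ZMod e) (x : ℤ), (x : ZMod e) = r →
    (x ∈ beta lam ↔ x < P r ∧ x ≠ g r ∨ x = T r)

variable {e : ℕ} {P g T : ZMod e → ℤ} {lam : YoungDiagram}

theorem modEq_iff_cast_eq (x y : ℤ) : x ≡ y [ZMOD e] ↔ (x : ZMod e) = y :=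
  (ZMod.intCast_eq_intCast_iff x y e).symm

theorem mem_gaps {b x : ℤ} : x ∈ gaps e lam b ↔ (x : ZMod e) = b ∧ x < b ∧ x ∉ beta lam := by
  rw [← modEq_iff_cast_eq]
  exact Iff.rfl

theorem IsHookAbacus.mem_beta_self (h : IsHookAbacus P g T lam) (x : ℤ) :
    x ∈ beta lam ↔ x < P x ∧ x ≠ g x ∨ x = T x := h.mem_beta _ x rfl

theorem IsHookAbacus.wt_of_lt_gap (h : IsHookAbacus P g T lam) {b : ℤ} (hb : b < g b) :
    wt e lam b = 0 := by
  have : gaps e lam b = ∅ := by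
    refine Set.eq_empty_of_forall_notMem fun x hx => ?_
    obtain ⟨h1, h2, h3⟩ := mem_gaps.1 hx
    rw [h.mem_beta _ x h1] at h3
    have := h.gap_add_le b
    omega
  rw [wt, this, Set.ncard_empty]

variable [NeZero e]

theorem IsHookAbacus.wt_of_gap_lt (h : IsHookAbacus P g T lam) {b : ℤ} (hb : g b < b)
    (hb' : b < P b) : wt e lam b = 1 := by
  have hpos := NeZero.pos e
  have hgb := add_le_of_lt_of_cast_eq hb (h.gap_cast b)
  have := h.top_cases b
  have : gaps e lam b = {g b} := by
    refine Set.eq_singleton_iff_unique_mem.2 ⟨?_, fun x hx => ?_⟩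
    · rw [mem_gaps, h.mem_beta _ _ (h.gap_cast b)]
      exact ⟨h.gap_cast b, hb, by omega⟩
    · obtain ⟨h1, h2, h3⟩ := mem_gaps.1 hx
      rw [h.mem_beta _ x h1] at h3
      omega
  rw [wt, this, Set.ncard_singleton]

/-- On an unmoved runner `b = P b - e`, and both sides are `0`. -/
theorem IsHookAbacus.wt_top (h : IsHookAbacus P g T lam) {b : ℤ} (hb : b = T b) :
    (wt e lam b : ℤ) * e = b - P b + e := by
  have hpos := NeZero.pos e
  have hg := h.gap_add_le b
  have hc := h.top_cases b
  rcases lt_or_ge b (P b) with hlt | hge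
  · have : gaps e lam b = ∅ := by
      refine Set.eq_empty_of_forall_notMem fun x hx => ?_
      obtain ⟨h1, h2, h3⟩ := mem_gaps.1 hx
      rw [h.mem_beta _ x h1] at h3
      omega
    rw [wt, this, Set.ncard_empty]
    simp
    omega
  · obtain ⟨n, hn⟩ : (e : ℤ) ∣ b - P b :=
      (ZMod.intCast_eq_intCast_iff_dvd_sub _ _ e).1 (h.base_cast b)
    have hn0 : 0 ≤ n := by
      by_contra! hneg
      have : (e : ℤ) * n < 0 := mul_neg_of_pos_of_neg (by omega) hneg
      omega
    lift n to ℕ using hn0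
    have hgaps : gaps e lam b =
        ((insert (g b) ((Finset.range n).image fun i : ℕ => P b + i * e) : Finset ℤ) : Set ℤ) := by
      ext x
      rw [mem_gaps]
      simp only [Finset.coe_insert, Finset.coe_image, Set.mem_insert_iff, Set.mem_image,
        Finset.coe_range, Set.mem_Iio]
      constructor
      · rintro ⟨h1, h2, h3⟩
        rw [h.mem_beta _ x h1] at h3
        by_cases hx : x = g b
        · exact Or.inl hx
        right
        obtain ⟨m, hm⟩ : (e : ℤ) ∣ x - P b :=
          (ZMod.intCast_eq_intCast_iff_dvd_sub _ _ e).1 ((h.base_cast b).trans h1.symm)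
        have hm0 : 0 ≤ m := by
          by_contra! hneg
          have : (e : ℤ) * m < 0 := mul_neg_of_pos_of_neg (by omega) hneg
          omega
        lift m to ℕ using hm0
        refine ⟨m, ?_, by linarith⟩
        have : (e : ℤ) * m < e * n := by omega
        exact_mod_cast lt_of_mul_lt_mul_left this (by omega)
      · rintro (rfl | ⟨i, hi, rfl⟩)
        · refine ⟨h.gap_cast b, by omega, ?_⟩
          rw [h.mem_beta _ _ (h.gap_cast b)]
          omega
        · have h1 : ((P b + i * e : ℤ) : ZMod e) = b := by simp [h.base_cast]
          have h2 : (i : ℤ) * e < n * e := mul_lt_mul_of_pos_right (by omega) (by omega)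
          have h3 : (0 : ℤ) ≤ i * e := by positivity
          rw [mul_comm] at hn
          refine ⟨h1, by omega, ?_⟩
          rw [h.mem_beta _ _ h1]
          omega
    have hcard : wt e lam b = n + 1 := by
      rw [wt, hgaps, Set.ncard_coe_finset, Finset.card_insert_of_notMem,
        Finset.card_image_of_injective, Finset.card_range]
      · intro i j hij
        have : (i : ℤ) * e = j * e := by simpa using hij
        exact_mod_cast mul_right_cancel₀ (by omega) this
      · simp only [Finset.mem_image, not_exists, not_and]
        intro i _ hi
        have h3 : (0 : ℤ) ≤ i * e := by positivity
        omega
    rw [hcard]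
    push_cast
    linarith

theorem IsHookAbacus.mem_movements_iff (h : IsHookAbacus P g T lam) (q b : ℤ) :
    toLex (q, b) ∈ movements e lam ↔
      g q < q ∧ q ≤ T q ∧ b = if q < P q then q else T q := by
  have hpos := NeZero.pos e
  rw [mem_movements]
  have hg := h.gap_add_le q
  have hc := h.top_cases q
  constructor
  · rintro ⟨hb, i, hi, hq⟩
    have hqb : (q : ZMod e) = b := by rw [hq]; simp
    rw [hqb] at hg hc ⊢
    rw [h.mem_beta_self] at hb
    by_cases hbT : b = T b
    · have h1 := h.wt_top hbT
      have h2 : (i : ℤ) * e + e ≤ wt e lam b * e := by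
        have : ((i : ℤ) + 1) * e ≤ wt e lam b * e :=
          mul_le_mul_of_nonneg_right (by omega) (by omega)
        linarith
      have h3 : (0 : ℤ) ≤ i * e := by positivity
      have h4 : ¬ q < P b := by omega
      rw [if_neg h4]
      omega
    · have hb2 : b < P b ∧ b ≠ g b := by tauto
      rcases lt_or_gt_of_ne hb2.2 with h1 | h1
      · rw [h.wt_of_lt_gap h1] at hi
        omega
      · rw [h.wt_of_gap_lt h1 hb2.1] at hi
        have := add_le_of_lt_of_cast_eq h1 (h.gap_cast b)
        obtain rfl : i = 0 := by omega
        obtain rfl : q = b := by simpa using hq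
        rw [if_pos hb2.1]
        omega
  · rintro ⟨h1, h2, rfl⟩
    have h3 := add_le_of_lt_of_cast_eq h1 (h.gap_cast q)
    split_ifs with hlt
    · refine ⟨(h.mem_beta_self q).2 (by omega), 0, ?_, by simp⟩
      rw [h.wt_of_gap_lt h1 hlt]
      exact one_pos
    · have hT := h.top_cast q
      refine ⟨(h.mem_beta _ _ hT).2 (Or.inr rfl), ?_⟩
      have h5 := h.wt_top (b := T q) (by rw [hT])
      rw [hT] at h5
      obtain ⟨n, hn⟩ : (e : ℤ) ∣ T q - q :=
        (ZMod.intCast_eq_intCast_iff_dvd_sub _ _ e).1 hT.symm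
      have hn0 : 0 ≤ n := by
        by_contra! hneg
        have : (e : ℤ) * n < 0 := mul_neg_of_pos_of_neg (by omega) hneg
        omega
      lift n to ℕ using hn0
      refine ⟨n, ?_, by linarith⟩
      have : (n : ℤ) * e < wt e lam (T q) * e := by
        rw [mul_comm] at hn
        omega
      exact_mod_cast lt_of_mul_lt_mul_right this (by omega)

/-- The core of a hook abacus has the beads below the base points. -/
theorem IsHookAbacus.image_beta (h : IsHookAbacus P g T lam) :
    (fun b : ℤ => b - (wt e lam b : ℤ) * e) '' beta lam = {x : ℤ | x < P x} := by
  have hpos := NeZero.pos e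
  ext x
  constructor
  · rintro ⟨b, hb, rfl⟩
    have hcast : ((b - (wt e lam b : ℤ) * e : ℤ) : ZMod e) = b := by simp
    show b - (wt e lam b : ℤ) * e < P ((b - (wt e lam b : ℤ) * e : ℤ) : ZMod e)
    rw [hcast]
    have hwt : (0 : ℤ) ≤ wt e lam b * e := by positivity
    rw [h.mem_beta_self] at hb
    rcases hb with hb | hb
    · omega
    · have := h.wt_top hb
      omega
  · intro hx
    have hx : x < P x := hx
    have hg := h.gap_add_le x
    have hc := h.top_cases x
    rcases lt_or_ge x (g x) with hxg | hxg
    · refine ⟨x, (h.mem_beta_self x).2 (by omega), ?_⟩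
      simp [h.wt_of_lt_gap hxg]
    · have h1 := add_le_of_lt_of_cast_eq hx (h.base_cast x).symm
      rcases h1.lt_or_eq with h2 | h2
      · have hcast : ((x + e : ℤ) : ZMod e) = x := intCast_add_self x
        refine ⟨x + e, (h.mem_beta x _ hcast).2 (by omega), ?_⟩
        dsimp only
        rw [h.wt_of_gap_lt (by rw [hcast]; omega) (by rw [hcast]; exact h2)]
        simp
      · have hT := h.top_cast x
        refine ⟨T x, (h.mem_beta x _ hT).2 (Or.inr rfl), ?_⟩
        have h5 := h.wt_top (b := T x) (by rw [hT])
        rw [hT] at h5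
        dsimp only
        omega

theorem exists_base_of_isECore {kap : YoungDiagram} (hkap : IsECore e kap) :
    ∃ P : ZMod e → ℤ, (∀ r, ((P r : ℤ) : ZMod e) = r) ∧ ∀ x : ℤ, x ∈ beta kap ↔ x < P x := by
  have hpos := NeZero.pos e
  have hclosed : ∀ b ∈ beta kap, ∀ x : ℤ, (x : ZMod e) = b → x < b → x ∈ beta kap := by
    intro b hb x hx hlt
    by_contra hxb
    have h1 : x ∈ gaps e kap b := mem_gaps.2 ⟨hx, hlt, hxb⟩
    have h2 : 0 < wt e kap b := (Set.ncard_pos (gaps_finite e kap b)).2 ⟨x, h1⟩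
    have h3 : b ∈ activeBeads e kap := by
      rw [activeBeads, Set.Finite.mem_toFinset]
      exact ⟨hb, h2⟩
    have h4 := Finset.sum_eq_zero_iff.1 hkap b h3
    omega
  have hex : ∀ r : ZMod e, ∃ p : ℤ, ((p : ZMod e) = r ∧ p ∉ beta kap) ∧
      ∀ x : ℤ, ((x : ZMod e) = r ∧ x ∉ beta kap) → p ≤ x := by
    intro r
    refine Int.exists_least_of_bdd ⟨-(kap.colLen 0 : ℤ), fun x hx => ?_⟩
      ⟨(r.val : ℤ) + (kap.rowLen 0) * e, ?_, fun hx => ?_⟩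
    · by_contra! hlt
      exact hx.2 (mem_beta_of_lt kap x hlt)
    · simp
    · have h1 := beta_lt kap _ hx
      have h2 : (kap.rowLen 0 : ℤ) * 1 ≤ kap.rowLen 0 * e :=
        mul_le_mul_of_nonneg_left (by omega) (by omega)
      omega
  choose P hP hmin using hex
  refine ⟨P, fun r => (hP r).1, fun x => ⟨fun hx => ?_, fun hx => ?_⟩⟩
  · by_contra! hle
    rcases hle.lt_or_eq with hlt | heq
    · exact (hP x).2 (hclosed x hx _ (hP x).1 hlt)
    · exact (hP x).2 (by rw [heq]; exact hx)
  · by_contra hxb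
    exact absurd (hmin x x ⟨rfl, hxb⟩) (not_le.2 hx)

end Abacus

/-! ### Hook quotients on the abacus -/

section HookQuotient

/-- A diagram is a hook if and only if at most one of its parts exceeds `1`. -/
theorem rowLen_one_ofRowLens_le_one_iff (l : List ℕ) (hl : l.SortedGE) :
    (YoungDiagram.ofRowLens l hl).rowLen 1 ≤ 1 ↔ (l.filter (2 ≤ ·)).length ≤ 1 := by
  rcases l with _ | ⟨a, _ | ⟨c, t⟩⟩
  · rw [ofRowLens_rowLen_of_le (by simp)]
    simp
  · rw [ofRowLens_rowLen_of_le (by simp)]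
    simp [List.filter_cons]
    split_ifs <;> simp
  · have h1 := YoungDiagram.rowLen_ofRowLens (hw := hl) ⟨1, by simp⟩
    simp only [Fin.getElem_fin, List.getElem_cons_succ, List.getElem_cons_zero] at h1
    rw [h1]
    have hp := hl.pairwise
    rw [List.pairwise_cons, List.pairwise_cons] at hp
    obtain ⟨hp1, hp2, -⟩ := hp
    have hac : c ≤ a := hp1 c (by simp)
    by_cases hc : 2 ≤ c
    · have ha : 2 ≤ a := hc.trans hac
      simp [hc, ha]
      omega
    · have ht : t.filter (2 ≤ ·) = [] := by
        rw [List.filter_eq_nil_iff]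
        intro x hx
        have : x ≤ c := hp2 x hx
        simp
        omega
      simp only [List.filter_cons, hc, ht]
      constructor
      · intro _
        split_ifs <;> simp_all
      · intro _
        omega

theorem mem_activeBeads {e : ℕ} {lam : YoungDiagram} {b : ℤ} :
    b ∈ activeBeads e lam ↔ b ∈ beta lam ∧ 0 < wt e lam b := by
  rw [activeBeads, Set.Finite.mem_toFinset]
  exact Iff.rfl

theorem isHook_eQuotient_iff (e : ℕ) (lam : YoungDiagram) (r : ℕ) :
    IsHook (eQuotient e lam r) ↔ ∀ b ∈ beta lam, ∀ c ∈ beta lam, b ≡ r [ZMOD e] →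
      c ≡ r [ZMOD e] → 2 ≤ wt e lam b → 2 ≤ wt e lam c → b = c := by
  classical
  rw [IsHook, eQuotient, rowLen_one_ofRowLens_le_one_iff]
  set s := (activeBeads e lam).filter fun b => b ≡ r [ZMOD e]
  have h1 : (((s.val.map (wt e lam)).sort (· ≥ ·)).filter (2 ≤ ·)).length =
      (s.filter fun b => 2 ≤ wt e lam b).card := by
    rw [← Multiset.coe_card, ← Multiset.filter_coe, Multiset.sort_eq, Multiset.filter_map,
      Multiset.card_map]
    rfl
  rw [h1, Finset.card_le_one]
  simp only [s, Finset.mem_filter, mem_activeBeads]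
  constructor
  · intro h b hb c hc hbr hcr hb2 hc2
    exact h b ⟨⟨⟨hb, by omega⟩, hbr⟩, hb2⟩ c ⟨⟨⟨hc, by omega⟩, hcr⟩, hc2⟩
  · intro h b hb c hc
    exact h b hb.1.1.1 c hc.1.1.1 hb.1.2 hc.1.2 hb.2 hc.2

variable {e : ℕ} {P g T : ZMod e → ℤ} {lam : YoungDiagram}

theorem wt_mono {b c : ℤ} (hbc : b ≤ c) (hcast : (b : ZMod e) = c) : wt e lam b ≤ wt e lam c := by
  refine Set.ncard_le_ncard (fun x hx => ?_) (gaps_finite e lam c)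
  rw [mem_gaps] at hx ⊢
  exact ⟨hx.1.trans hcast, by omega, hx.2.2⟩

variable [NeZero e]

theorem isHookQuotient_iff : IsHookQuotient e lam ↔ ∀ b ∈ beta lam, ∀ c ∈ beta lam,
    (b : ZMod e) = c → 2 ≤ wt e lam b → 2 ≤ wt e lam c → b = c := by
  have hval : ∀ r : ZMod e, (((r.val : ℕ) : ℤ) : ZMod e) = r := fun r => by simp
  simp only [IsHookQuotient, isHook_eQuotient_iff, modEq_iff_cast_eq]
  constructor
  · intro h b hb c hc hbc
    exact h (b : ZMod e).val (ZMod.val_lt _) b hb c hc (hval _).symm (by rw [hval, hbc])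
  · intro h r _ b hb c hc hbr hcr
    exact h b hb c hc (hbr.trans hcr.symm)

/-- On a runner, every bead but the last has at most one gap before it: the weight increases along a
runner, and only one bead can have weight at least `2`. -/
theorem IsHookQuotient.eq_of_mem_gaps (h : IsHookQuotient e lam) {b c x y : ℤ} (hb : b ∈ beta lam)
    (hc : c ∈ beta lam) (hlt : b < c) (hcast : (b : ZMod e) = c) (hx : x ∈ gaps e lam b)
    (hy : y ∈ gaps e lam b) : x = y := by
  by_contra hne
  have h1 : 2 ≤ wt e lam b :=
    (Set.one_lt_ncard (gaps_finite e lam b)).2 ⟨x, hx, y, hy, hne⟩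
  have := isHookQuotient_iff.1 h b hb c hc hcast h1 (h1.trans (wt_mono hlt.le hcast))
  omega

theorem IsHookQuotient.exists_isHookAbacus (h : IsHookQuotient e lam) :
    ∃ P g T : ZMod e → ℤ, IsHookAbacus P g T lam := by
  have hpos := NeZero.pos e
  have key : ∀ r : ZMod e, ∃ p g t : ℤ, (p : ZMod e) = r ∧ (g : ZMod e) = r ∧ (t : ZMod e) = r ∧
      g + e ≤ p ∧ (p ≤ t ∨ t = g ∧ g + e = p) ∧
      ∀ x : ℤ, (x : ZMod e) = r → (x ∈ beta lam ↔ x < p ∧ x ≠ g ∨ x = t) := by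
    intro r
    obtain ⟨g, ⟨hgr, hgb⟩, hgmin⟩ := Int.exists_least_of_bdd
      (P := fun x : ℤ => (x : ZMod e) = r ∧ x ∉ beta lam)
      ⟨-(lam.colLen 0 : ℤ), fun x hx => by
        by_contra! hlt
        exact hx.2 (mem_beta_of_lt lam x hlt)⟩
      ⟨(r.val : ℤ) + (lam.rowLen 0) * e, by simp, fun hx => by
        have h1 := beta_lt lam _ hx
        have h2 : (lam.rowLen 0 : ℤ) * 1 ≤ lam.rowLen 0 * e :=
          mul_le_mul_of_nonneg_left (by omega) (by omega)
        omega⟩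
    have hlow : ∀ x : ℤ, (x : ZMod e) = r → x < g → x ∈ beta lam := by
      intro x hx hlt
      by_contra hxb
      exact absurd (hgmin x ⟨hx, hxb⟩) (not_le.2 hlt)
    by_cases hex : ∃ b : ℤ, (b : ZMod e) = r ∧ b ∈ beta lam ∧ g < b
    · obtain ⟨t, ⟨htr, htb, hgt⟩, htmax⟩ := Int.exists_greatest_of_bdd
        (P := fun x : ℤ => (x : ZMod e) = r ∧ x ∈ beta lam ∧ g < x)
        ⟨lam.rowLen 0, fun x hx => (beta_lt lam x hx.2.1).le⟩ hex
      -- between the first gap `g` and `p` there are only beads; a bead from `p` on, other than the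
      -- last one `t`, would have the two gaps `g` and `p` before it
      obtain ⟨p, ⟨hpr, hgp, hpb⟩, hpmin⟩ := Int.exists_least_of_bdd
        (P := fun x : ℤ => (x : ZMod e) = r ∧ g < x ∧ (x ∉ beta lam ∨ x = t))
        ⟨g, fun x hx => hx.2.1.le⟩ ⟨t, htr, hgt, Or.inr rfl⟩
      have hpt := hpmin t ⟨htr, hgt, Or.inr rfl⟩
      refine ⟨p, g, t, hpr, hgr, htr, add_le_of_lt_of_cast_eq hgp (hgr.trans hpr.symm),
        Or.inl hpt, fun x hx => ⟨fun hxb => ?_, ?_⟩⟩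
      · by_contra! hne
        have hxg : x ≠ g := fun h => hgb (h ▸ hxb)
        have hpx : p ≤ x := by
          by_contra! hlt
          exact hxg (hne.1 hlt)
        have hxt := htmax x ⟨hx, hxb, by omega⟩
        have hpb' : p ∉ beta lam := hpb.resolve_right (by omega)
        have hpne : p ≠ x := fun h => hpb' (h ▸ hxb)
        have := h.eq_of_mem_gaps hxb htb (by omega) (hx.trans htr.symm)
          (mem_gaps.2 ⟨hgr.trans hx.symm, by omega, hgb⟩)
          (mem_gaps.2 ⟨hpr.trans hx.symm, by omega, hpb'⟩)
        omega
      · rintro (⟨h1, h2⟩ | rfl)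
        · by_contra hxb
          rcases lt_or_gt_of_ne h2 with h3 | h3
          · exact hxb (hlow x hx h3)
          · exact absurd (hpmin x ⟨hx, h3, Or.inl hxb⟩) (not_le.2 h1)
        · exact htb
    · push Not at hex
      refine ⟨g, g - e, g - e, hgr, by simp [hgr], by simp [hgr], by omega, by omega,
        fun x hx => ⟨fun hxb => ?_, fun hx' => hlow x hx (by omega)⟩⟩
      have h1 := hex x hx hxb
      have h2 : x ≠ g := fun h => hgb (h ▸ hxb)
      omega
  choose P g T h1 h2 h3 h4 h5 h6 using key
  exact ⟨P, g, T, h1, h2, h3, h4, h5, h6⟩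

/-- The base points of the abacus of `lam` are those of its core. -/
theorem exists_isHookAbacus {kap : YoungDiagram} (hP : ∀ r, ((P r : ℤ) : ZMod e) = r)
    (hkap : ∀ x : ℤ, x ∈ beta kap ↔ x < P x) {w : ℕ} (h : lam ∈ hookQuotientBlock e kap w) :
    ∃ g T : ZMod e → ℤ, IsHookAbacus P g T lam := by
  obtain ⟨⟨hcore, -⟩, hhook⟩ := h
  obtain ⟨P', g, T, habacus⟩ := hhook.exists_isHookAbacus
  have h1 := habacus.image_beta
  rw [← hcore] at h1
  have h2 : ∀ x : ℤ, x < P x ↔ x < P' x := fun x => by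
    rw [← hkap, h1]
    exact Iff.rfl
  obtain rfl : P' = P := by
    ext r
    have a1 := h2 (P r)
    have a2 := h2 (P' r)
    rw [hP] at a1
    rw [habacus.base_cast] at a2
    omega
  exact ⟨g, T, habacus⟩

theorem IsHookAbacus.isHookQuotient (h : IsHookAbacus P g T lam) : IsHookQuotient e lam := by
  have key : ∀ b ∈ beta lam, 2 ≤ wt e lam b → b = T b := by
    intro b hb hwt
    by_contra hne
    rcases (h.mem_beta_self b).1 hb with ⟨h1, h2⟩ | h1
    · rcases lt_or_gt_of_ne h2 with h3 | h3
      · rw [h.wt_of_lt_gap h3] at hwt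
        omega
      · rw [h.wt_of_gap_lt h3 h1] at hwt
        omega
    · exact hne h1
  refine isHookQuotient_iff.2 fun b hb c hc hbc hb2 hc2 => ?_
  rw [key b hb hb2, key c hc hc2, hbc]

end HookQuotient

/-! ### Starting positions form a configuration -/

section StartPos

variable {e : ℕ} {P g T : ZMod e → ℤ} {lam : YoungDiagram} {w : ℕ}

theorem movement_mem (h : eWeight e lam = w) (i : Fin w) :
    toLex (startPos e h i, beadPos e h i) ∈ movements e lam :=
  (movements e lam).orderEmbOfFin_mem ((card_movements e lam).trans h) i

variable [NeZero e]

theorem IsHookAbacus.beadPos_eq (ha : IsHookAbacus P g T lam) (h : eWeight e lam = w) (i : Fin w) :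
    beadPos e h i = if startPos e h i < P (startPos e h i) then startPos e h i
      else T (startPos e h i) :=
  ((ha.mem_movements_iff _ _).1 (movement_mem h i)).2.2

theorem IsHookAbacus.exists_startPos_iff (ha : IsHookAbacus P g T lam) (h : eWeight e lam = w)
    (y : ℤ) : (∃ i, startPos e h i = y) ↔ g y < y ∧ y ≤ T y := by
  constructor
  · rintro ⟨i, rfl⟩
    have := (ha.mem_movements_iff _ _).1 (movement_mem h i)
    exact ⟨this.1, this.2.1⟩
  · rintro ⟨h1, h2⟩
    have hm := (ha.mem_movements_iff y _).2 ⟨h1, h2, rfl⟩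
    rw [← Finset.mem_coe,
      ← Finset.range_orderEmbOfFin _ ((card_movements e lam).trans h)] at hm
    obtain ⟨i, hi⟩ := hm
    exact ⟨i, congrArg (fun p => (ofLex p).1) hi⟩

theorem IsHookAbacus.strictMono_startPos (ha : IsHookAbacus P g T lam) (h : eWeight e lam = w) :
    StrictMono (startPos e h) := by
  intro i j hij
  have h1 : movement e h i < movement e h j :=
    ((movements e lam).orderEmbOfFin ((card_movements e lam).trans h)).strictMono hij
  rcases Prod.Lex.lt_iff.1 h1 with h2 | ⟨h2, h3⟩
  · exact h2
  · have h2 : startPos e h i = startPos e h j := h2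
    have h3 : beadPos e h i < beadPos e h j := h3
    rw [ha.beadPos_eq, ha.beadPos_eq, h2] at h3
    exact absurd h3 (lt_irrefl _)

theorem IsHookAbacus.isHookConfig (ha : IsHookAbacus P g T lam) (h : eWeight e lam = w) :
    IsHookConfig P (startPos e h) := by
  have hpos := NeZero.pos e
  refine ⟨ha.strictMono_startPos h, fun i hi => ?_, fun i hi => ?_⟩
  · have h1 := (ha.exists_startPos_iff h _).1 ⟨i, rfl⟩
    have h2 := add_le_of_lt_of_cast_eq hi (ha.base_cast _).symm
    have h3 := add_le_of_lt_of_cast_eq h1.1 (ha.gap_cast _)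
    have h4 := ha.top_cases (startPos e h i)
    rw [ha.exists_startPos_iff h, intCast_add_self]
    omega
  · have h1 := (ha.exists_startPos_iff h _).1 ⟨i, rfl⟩
    have h2 := add_le_of_lt_of_cast_eq hi (ha.base_cast _)
    have h4 := ha.gap_add_le (startPos e h i)
    rw [ha.exists_startPos_iff h, intCast_sub_self]
    omega

theorem IsHookAbacus.exists_startPos_eq_base (ha : IsHookAbacus P g T lam) (h : eWeight e lam = w)
    (i : Fin w) : ∃ p, startPos e h p = P (startPos e h i) := by
  have hpos := NeZero.pos e
  have h1 := (ha.exists_startPos_iff h _).1 ⟨i, rfl⟩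
  have h3 := add_le_of_lt_of_cast_eq h1.1 (ha.gap_cast _)
  have h4 := ha.top_cases (startPos e h i)
  have h5 := ha.gap_add_le (startPos e h i)
  rw [ha.exists_startPos_iff h, ha.base_cast]
  omega

theorem isTightBasis_modifiedBasis {q b : Fin w → ℤ} (hq : IsHookConfig P q)
    (hP : ∀ r, ((P r : ℤ) : ZMod e) = r) (hbase : ∀ i, ∃ p, q p = P (q i))
    (hb : ∀ i, b i = if q i < P (q i) then q i else T (q i)) (hT : ∀ i, q i ≤ T (q i)) :
    IsTightBasis P q (modifiedBasis e q b) := by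
  have hpos := NeZero.pos e
  have hrun : ∀ i k, k ∈ runner e q i ↔ (q k : ZMod e) = q i := fun i k => by
    simp [runner, modEq_iff_cast_eq]
  intro i
  obtain ⟨p, hp⟩ := hbase i
  have hpi : (q p : ZMod e) = q i := by rw [hp, hP]
  have hlast : b (lastIdx e q i) = T (q i) := by
    have h1 : lastIdx e q i ∈ runner e q i := Finset.max'_mem _ _
    have h2 : p ≤ lastIdx e q i := Finset.le_max' _ _ ((hrun i p).2 hpi)
    have h3 := hq.strictMono.monotone h2
    rw [hb, (hrun _ _).1 h1, if_neg (by omega)]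
  have hpivot : pivot e q b i = p := by
    refine le_antisymm (Finset.min'_le _ _ ?_) (Finset.le_min' _ _ _ fun k hk => ?_)
    · rw [Finset.mem_filter, hlast, hb, hpi, if_neg (by omega)]
      exact ⟨(hrun i p).2 hpi, rfl⟩
    · obtain ⟨h1, h2⟩ := Finset.mem_filter.1 hk
      rw [hrun] at h1
      by_contra! hlt
      have h3 := hq.strictMono hlt
      rw [hlast, hb, h1, if_pos (by omega)] at h2
      have h4 := hT p
      rw [hpi] at h4
      omega
  rcases lt_trichotomy i p with hlt | heq | hgt
  · have h1 : q i < P (q i) := by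
      have := hq.strictMono hlt
      omega
    obtain ⟨k, hk⟩ := hq.up i h1
    refine Or.inr (Or.inl ⟨h1, k, hk, ?_⟩)
    have h2 : i < pivot e q b i := by rw [hpivot]; exact hlt
    have h3 : nextIdx e q b i h2 = k := by
      refine le_antisymm (Finset.min'_le _ _ ?_) (Finset.le_min' _ _ _ fun m hm => ?_)
      · rw [Finset.mem_filter, hrun, hk, intCast_add_self]
        exact ⟨rfl, hq.strictMono.lt_iff_lt.1 (by omega)⟩
      · obtain ⟨h4, h5⟩ := Finset.mem_filter.1 hm
        have := add_le_of_lt_of_cast_eq (hq.strictMono h5) ((hrun i m).1 h4).symm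
        exact hq.strictMono.le_iff_le.1 (by omega)
    rw [modifiedBasis, dif_pos h2, h3]
  · subst heq
    refine Or.inl ⟨hp, ?_⟩
    rw [modifiedBasis, dif_neg (by rw [hpivot]; exact lt_irrefl _),
      dif_neg (by rw [hpivot]; exact lt_irrefl _)]
  · have h1 : P (q i) < q i := by
      have := hq.strictMono hgt
      omega
    obtain ⟨k, hk⟩ := hq.down i h1
    refine Or.inr (Or.inr ⟨h1, k, hk, ?_⟩)
    have h2 : pivot e q b i < i := by rw [hpivot]; exact hgt
    have h3 : prevIdx e q b i h2 = k := by
      refine le_antisymm (Finset.max'_le _ _ _ fun m hm => ?_) (Finset.le_max' _ _ ?_)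
      · obtain ⟨h4, h5⟩ := Finset.mem_filter.1 hm
        have := add_le_of_lt_of_cast_eq (hq.strictMono h5) ((hrun i m).1 h4)
        exact hq.strictMono.le_iff_le.1 (by omega)
      · rw [Finset.mem_filter, hrun, hk, intCast_sub_self]
        exact ⟨rfl, hq.strictMono.lt_iff_lt.1 (by omega)⟩
    rw [modifiedBasis, dif_neg h2.not_gt, dif_pos h2, h3]

theorem IsHookAbacus.isTightBasis (ha : IsHookAbacus P g T lam) (h : eWeight e lam = w) :
    IsTightBasis P (startPos e h) (eps e h) :=
  isTightBasis_modifiedBasis (T := T) (ha.isHookConfig h) ha.base_cast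
    (ha.exists_startPos_eq_base h) (ha.beadPos_eq h)
    fun i => ((ha.exists_startPos_iff h _).1 ⟨i, rfl⟩).2

/-- The slope without the one-sided choices at the kinks, in a form to compare with arm lengths. -/
theorem IsHookConfig.slope_eq {q : Fin w → ℤ} (hq : IsHookConfig P q)
    (hP : ∀ r, ((P r : ℤ) : ZMod e) = r) (i : Fin w) :
    slope P q i = (Finset.univ.filter fun r => P r ≤ q i).card +
      (Finset.univ.filter fun k => q i < q k ∧ q k ≤ q i + e).card -
      (Finset.univ.filter fun k => q i < q k + e ∧ q k ≤ q i).card := by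
  have hpos := NeZero.pos e
  have hpair : ∀ a b, pairSlope P q a b =
      if q a < q b ∧ (q b < q a + e ∨ q b = q a + e ∧ P (q a) ≤ q a) then 1 else 0 := fun a b =>
    if_congr (and_congr_left' hq.strictMono.lt_iff_lt.symm) rfl rfl
  have hinj : ∀ a b, q a = q b ↔ a = b := fun a b => hq.strictMono.injective.eq_iff
  have hsum : ∀ (α : Type) [Fintype α] [DecidableEq α] (a : α) (p : Prop) [Decidable p],
      ∑ k : α, (if k = a ∧ p then (1 : ℤ) else 0) = if p then 1 else 0 := by
    intro α _ _ a p _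
    simp only [ite_and, Finset.sum_ite_eq', Finset.mem_univ, if_true]
  have e1 : ∑ r, (if P r < q i then (1 : ℤ) else 0) + (if q i = P (q i) then 1 else 0) =
      (Finset.univ.filter fun r => P r ≤ q i).card := by
    rw [← hsum (ZMod e) (q i : ZMod e) (q i = P (q i)), ← Finset.sum_add_distrib,
      Finset.natCast_card_filter]
    refine Finset.sum_congr rfl fun r _ => ?_
    have h1 : q i = P r ↔ r = q i ∧ q i = P (q i) := by
      constructor
      · intro h
        have : (q i : ZMod e) = r := by rw [h, hP]
        exact ⟨this.symm, by rw [this]; exact h⟩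
      · rintro ⟨rfl, h⟩
        exact h
    rw [if_congr h1.symm rfl rfl]
    split_ifs <;> omega
  have e2 : ∑ k, pairSlope P q i k + (if q i < P (q i) then 1 else 0) =
      (Finset.univ.filter fun k => q i < q k ∧ q k ≤ q i + e).card := by
    rw [Finset.natCast_card_filter]
    by_cases h1 : q i < P (q i)
    · obtain ⟨m, hm⟩ := hq.up i h1
      rw [← hsum (Fin w) m, ← Finset.sum_add_distrib]
      refine Finset.sum_congr rfl fun k _ => ?_
      simp only [hpair, ← hinj k m]
      split_ifs <;> omega
    · rw [if_neg h1, add_zero]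
      refine Finset.sum_congr rfl fun k _ => ?_
      simp only [hpair]
      split_ifs <;> omega
  have e3 : ∑ k, pairSlope P q k i + (∑ k : Fin w, if k = i then 1 else 0) =
      (if P (q i) < q i then 1 else 0) +
      (Finset.univ.filter fun k => q i < q k + e ∧ q k ≤ q i).card := by
    rw [Finset.natCast_card_filter]
    by_cases h1 : P (q i) < q i
    · obtain ⟨m, hm⟩ := hq.down i h1
      have h2 := add_le_of_lt_of_cast_eq h1 (hP _)
      rw [← hsum (Fin w) m, ← Finset.sum_add_distrib, ← Finset.sum_add_distrib]
      refine Finset.sum_congr rfl fun k _ => ?_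
      have h3 : q i = q k + e → P (q k) = P (q i) := fun h => by rw [h, intCast_add_self]
      simp only [hpair, ← hinj k m, ← hinj k i]
      split_ifs <;> omega
    · rw [if_neg h1, zero_add, ← Finset.sum_add_distrib]
      refine Finset.sum_congr rfl fun k _ => ?_
      have h3 : q i = q k + e → P (q k) = P (q i) := fun h => by rw [h, intCast_add_self]
      simp only [hpair, ← hinj k i]
      split_ifs <;> omega
  have h0 : (∑ k : Fin w, if k = i then (1 : ℤ) else 0) = 1 := by simp
  rw [h0] at e3
  rw [slope]
  split_ifs at e1 e2 e3 <;> omega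

theorem IsHookAbacus.label_eq (ha : IsHookAbacus P g T lam) (h : eWeight e lam = w) :
    label e h = slope P (startPos e h) := by
  classical
  have hpos := NeZero.pos e
  ext i
  rw [(ha.isHookConfig h).slope_eq ha.base_cast]
  have hstrict := ha.strictMono_startPos h
  have hex := ha.exists_startPos_iff h
  simp only [label]
  generalize startPos e h = q at *
  have h1 : (armLength e (beta lam) (q i) : ℤ) =
      ∑ y ∈ Finset.Ioc (q i - e) (q i), if y ∉ beta lam then 1 else 0 := by
    rw [← Finset.natCast_card_filter, armLength]
    congr 1
    rw [← Set.ncard_coe_finset]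
    congr 1
    ext y
    simp
  -- unoccupied positions in terms of base points and starting positions
  have h2 : ∀ y : ℤ, (if y ∉ beta lam then (1 : ℤ) else 0) = (if P y ≤ y then 1 else 0) +
      (if ∃ k, q k = y + e then 1 else 0) - (if ∃ k, q k = y then 1 else 0) := by
    intro y
    have a1 := ha.gap_add_le y
    have a2 := ha.top_cases y
    have a3 : ∀ c : ℤ, (c : ZMod e) = y → c < y → c + e ≤ y :=
      fun c hc hlt => add_le_of_lt_of_cast_eq hlt hc
    have a4 : ∀ c : ℤ, (c : ZMod e) = y → y < c → y + e ≤ c :=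
      fun c hc hlt => add_le_of_lt_of_cast_eq hlt hc.symm
    have b1 := a3 _ (ha.base_cast y)
    have b2 := a3 _ (ha.gap_cast y)
    have b3 := a3 _ (ha.top_cast y)
    have c1 := a4 _ (ha.base_cast y)
    have c2 := a4 _ (ha.gap_cast y)
    have c3 := a4 _ (ha.top_cast y)
    simp only [hex, intCast_add_self, ha.mem_beta_self]
    split_ifs <;> omega
  rw [h1, Finset.sum_congr rfl fun y _ => h2 y, Finset.sum_sub_distrib, Finset.sum_add_distrib,
    ← Finset.natCast_card_filter, ← Finset.natCast_card_filter, ← Finset.natCast_card_filter]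
  congr 2
  · congr 1
    refine Finset.card_bij (fun y _ => (y : ZMod e)) ?_ ?_ ?_
    · intro y hy
      simp only [Finset.mem_filter, Finset.mem_Ioc, Finset.mem_univ, true_and] at hy ⊢
      omega
    · intro y hy z hz hyz
      simp only [Finset.mem_filter, Finset.mem_Ioc] at hy hz
      have b1 := add_le_of_lt_of_cast_eq (e := e) (x := y) (y := z)
      have b2 := add_le_of_lt_of_cast_eq (e := e) (x := z) (y := y)
      simp only [hyz, forall_const] at b1 b2
      omega
    · intro r hr
      simp only [Finset.mem_filter, Finset.mem_univ, true_and] at hr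
      have c1 := Int.emod_nonneg (q i - P r) (by omega : (e : ℤ) ≠ 0)
      have c2 := Int.emod_lt_of_pos (q i - P r) (by omega : (0 : ℤ) < e)
      have c3 := Int.emod_add_mul_ediv (q i - P r) e
      have c4 : ((q i - (q i - P r) % e : ℤ) : ZMod e) = r := by
        have : q i - (q i - P r) % e = P r + e * ((q i - P r) / e) := by linarith
        rw [this]
        simp [ha.base_cast]
      refine ⟨q i - (q i - P r) % e, ?_, c4⟩
      rw [Finset.mem_filter, c4, Finset.mem_Ioc]
      refine ⟨by omega, ?_⟩
      by_contra! hlt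
      have := add_le_of_lt_of_cast_eq hlt (c4.trans (ha.base_cast r).symm)
      omega
  · symm
    congr 1
    refine Finset.card_bij (fun k _ => q k - e) ?_ ?_ ?_
    · intro k hk
      simp only [Finset.mem_filter, Finset.mem_Ioc, Finset.mem_univ, true_and] at hk ⊢
      exact ⟨by omega, k, by omega⟩
    · intro k _ m _ hkm
      exact hstrict.injective (by omega)
    · intro y hy
      simp only [Finset.mem_filter, Finset.mem_Ioc, Finset.mem_univ, true_and] at hy ⊢
      obtain ⟨hy1, k, hk⟩ := hy
      exact ⟨k, by omega, by omega⟩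
  · symm
    refine Finset.card_bij (fun k _ => q k) ?_ ?_ ?_
    · intro k hk
      simp only [Finset.mem_filter, Finset.mem_Ioc, Finset.mem_univ, true_and] at hk ⊢
      exact ⟨by omega, k, rfl⟩
    · intro k _ m _ hkm
      exact hstrict.injective hkm
    · intro y hy
      simp only [Finset.mem_filter, Finset.mem_Ioc, Finset.mem_univ, true_and] at hy ⊢
      obtain ⟨hy1, k, hk⟩ := hy
      exact ⟨k, by omega, hk⟩

end StartPos

/-! ### Realizing a configuration by a partition -/

section Realization

variable {e : ℕ} [NeZero e] {P : ZMod e → ℤ} {w : ℕ}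

theorem IsHookConfig.exists_eq_base {q : Fin w → ℤ} (hq : IsHookConfig P q)
    (hP : ∀ r, ((P r : ℤ) : ZMod e) = r) (i : Fin w) : ∃ p, q p = P (q i) := by
  obtain ⟨p, hp, hmin⟩ := Finset.exists_min_image
    (Finset.univ.filter fun k => (q k : ZMod e) = q i) (fun k => |q k - P (q i)|) ⟨i, by simp⟩
  simp only [Finset.mem_filter, Finset.mem_univ, true_and] at hp hmin
  have hpos := NeZero.pos e
  refine ⟨p, ?_⟩
  by_contra hne
  rcases lt_or_gt_of_ne hne with h1 | h1
  · obtain ⟨k, hk⟩ := hq.up p (by rw [hp]; exact h1)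
    have h2 := add_le_of_lt_of_cast_eq h1 (hp.trans (hP _).symm)
    have h3 := hmin k (by rw [hk, intCast_add_self, hp])
    rw [hk, abs_of_nonpos (by omega), abs_of_nonpos (by omega)] at h3
    omega
  · obtain ⟨k, hk⟩ := hq.down p (by rw [hp]; exact h1)
    have h2 := add_le_of_lt_of_cast_eq h1 ((hP _).trans hp.symm)
    have h3 := hmin k (by rw [hk, intCast_sub_self, hp])
    rw [hk, abs_of_nonneg (by omega), abs_of_nonneg (by omega)] at h3
    omega

theorem IsHookConfig.exists_interval {q : Fin w → ℤ} (hq : IsHookConfig P q)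
    (hP : ∀ r, ((P r : ℤ) : ZMod e) = r) (r : ZMod e) :
    ∃ g t : ℤ, (g : ZMod e) = r ∧ (t : ZMod e) = r ∧ g + e ≤ P r ∧
      (P r ≤ t ∨ t = g ∧ g + e = P r) ∧
      ∀ y : ℤ, (y : ZMod e) = r → ((∃ k, q k = y) ↔ g < y ∧ y ≤ t) := by
  have hpos := NeZero.pos e
  by_cases hex : ∃ i, (q i : ZMod e) = r
  · obtain ⟨i, hi⟩ := hex
    obtain ⟨p, hp⟩ := hq.exists_eq_base hP i
    rw [hi] at hp
    have hne : (Finset.univ.filter fun k => (q k : ZMod e) = r).Nonempty := ⟨i, by simp [hi]⟩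
    obtain ⟨a, ha, hamin⟩ := Finset.exists_min_image _ q hne
    obtain ⟨b, hb, hbmax⟩ := Finset.exists_max_image _ q hne
    simp only [Finset.mem_filter, Finset.mem_univ, true_and] at ha hamin hb hbmax
    have hpr : (q p : ZMod e) = r := by rw [hp, hP]
    have hap := hamin p hpr
    have hbp := hbmax p hpr
    refine ⟨q a - e, q b, by rw [intCast_sub_self, ha], hb, by omega, by omega,
      fun y hy => ⟨?_, fun ⟨h1, h2⟩ => ?_⟩⟩
    · rintro ⟨k, rfl⟩
      have := hamin k hy
      have := hbmax k hy
      omega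
    · have h3 : q a ≤ y := by
        have := add_le_of_lt_of_cast_eq h1 (by rw [intCast_sub_self, ha, hy])
        omega
      rcases le_or_gt (P r) y with hge | hlt
      · -- the least starting position that is at least `y` equals `y`
        obtain ⟨k, hk, hkmin⟩ := Finset.exists_min_image
          (Finset.univ.filter fun k => (q k : ZMod e) = r ∧ y ≤ q k) q ⟨b, by simp [hb, h2]⟩
        simp only [Finset.mem_filter, Finset.mem_univ, true_and] at hk hkmin
        refine ⟨k, ?_⟩
        by_contra hne
        have h4 := add_le_of_lt_of_cast_eq (lt_of_le_of_ne hk.2 (Ne.symm hne)) (hy.trans hk.1.symm)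
        obtain ⟨m, hm⟩ := hq.down k (by rw [hk.1]; omega)
        have := hkmin m ⟨by rw [hm, intCast_sub_self, hk.1], by omega⟩
        omega
      · obtain ⟨k, hk, hkmax⟩ := Finset.exists_max_image
          (Finset.univ.filter fun k => (q k : ZMod e) = r ∧ q k ≤ y) q ⟨a, by simp [ha, h3]⟩
        simp only [Finset.mem_filter, Finset.mem_univ, true_and] at hk hkmax
        refine ⟨k, ?_⟩
        by_contra hne
        have h4 := add_le_of_lt_of_cast_eq (lt_of_le_of_ne hk.2 hne) (hk.1.trans hy.symm)
        obtain ⟨m, hm⟩ := hq.up k (by rw [hk.1]; omega)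
        have := hkmax m ⟨by rw [hm, intCast_add_self, hk.1], by omega⟩
        omega
  · refine ⟨P r - e, P r - e, by rw [intCast_sub_self, hP], by rw [intCast_sub_self, hP],
      by omega, by omega, fun y hy => ⟨?_, fun h => by omega⟩⟩
    rintro ⟨k, rfl⟩
    exact absurd ⟨k, hy⟩ hex

/-- Every configuration is the sequence of starting positions of a hook-quotient partition in the
block. -/
theorem exists_partition {kap : YoungDiagram} (hP : ∀ r, ((P r : ℤ) : ZMod e) = r)
    (hkap : ∀ x : ℤ, x ∈ beta kap ↔ x < P x) {q : Fin w → ℤ} (hq : IsHookConfig P q) :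
    ∃ lam : hookQuotientBlock e kap w, startPos e lam.2.1.2 = q := by
  have hpos := NeZero.pos e
  choose g T hg hT hgP hTP hmem using hq.exists_interval hP
  obtain ⟨lam, hlam⟩ := exists_beta_eq_image kap (fun x => if x = g x then T x else x) (by
    intro x hx y hy hxy
    have hx := (hkap x).1 hx
    have hy := (hkap y).1 hy
    dsimp only at hxy
    split_ifs at hxy with h1 h2 h2
    · have h3 := congrArg (Int.cast : ℤ → ZMod e) hxy
      rw [hT, hT] at h3
      rw [h1, h2, h3]
    · have h3 := congrArg (Int.cast : ℤ → ZMod e) hxy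
      rw [hT] at h3
      have := hTP x
      rw [← h3] at hy h2
      omega
    · have h3 := congrArg (Int.cast : ℤ → ZMod e) hxy
      rw [hT] at h3
      have := hTP y
      rw [h3] at hx h1
      omega
    · exact hxy) (by
    obtain ⟨M, hM⟩ := (Set.finite_range fun r => max |g r| |T r|).bddAbove
    refine ⟨M.toNat, fun x hx => ?_⟩
    have h1 : max |g x| |T x| ≤ M := hM ⟨x, rfl⟩
    have h2 := (abs_le.1 ((le_max_left _ _).trans h1)).1
    have h3 := (abs_le.1 ((le_max_right _ _).trans h1)).1
    split_ifs at hx ⊢ with h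
    · omega
    · exact absurd rfl hx)
  have ha : IsHookAbacus P g T lam := by
    refine ⟨hP, hg, hT, hgP, hTP, fun r x hx => ?_⟩
    rw [hlam]
    constructor
    · rintro ⟨y, hy, rfl⟩
      have hy := (hkap y).1 hy
      dsimp only at hx ⊢
      split_ifs at hx ⊢ with h
      · rw [hT] at hx
        rw [hx]
        exact Or.inr rfl
      · rw [hx] at hy h
        exact Or.inl ⟨hy, h⟩
    · rintro (⟨h1, h2⟩ | rfl)
      · exact ⟨x, (hkap x).2 (by rw [hx]; exact h1), if_neg (by rw [hx]; exact h2)⟩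
      · refine ⟨g r, (hkap _).2 ?_, ?_⟩
        · have := hgP r
          rw [hg]
          omega
        · simp [hg]
  have hcore : IsECoreOf e kap lam := by
    rw [IsECoreOf, ha.image_beta]
    exact Set.ext hkap
  have hmov : movements e lam =
      Finset.univ.image fun i => toLex (q i, if q i < P (q i) then q i else T (q i)) := by
    ext p
    obtain ⟨⟨y, b⟩, rfl⟩ := toLex.surjective p
    rw [ha.mem_movements_iff, ← and_assoc, ← hmem y y rfl]
    simp only [Finset.mem_image, Finset.mem_univ, true_and, toLex_inj, Prod.mk.injEq]
    constructor
    · rintro ⟨⟨k, rfl⟩, rfl⟩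
      exact ⟨k, rfl, rfl⟩
    · rintro ⟨k, rfl, rfl⟩
      exact ⟨⟨k, rfl⟩, rfl⟩
  have hw : eWeight e lam = w := by
    rw [← card_movements, hmov, Finset.card_image_of_injective, Finset.card_univ, Fintype.card_fin]
    intro i j hij
    exact hq.strictMono.injective (congrArg (fun p => (ofLex p).1) hij)
  refine ⟨⟨lam, ⟨hcore, hw⟩, ha.isHookQuotient⟩, ?_⟩
  refine ((ha.strictMono_startPos hw).range_inj hq.strictMono).1 (Set.ext fun y => ?_)
  exact (ha.exists_startPos_iff hw y).trans (hmem y y rfl).symm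

/-- The starting positions determine the beta-numbers. -/
theorem IsHookAbacus.mem_beta_iff_exists {g T : ZMod e → ℤ} {lam : YoungDiagram}
    (ha : IsHookAbacus P g T lam) (h : eWeight e lam = w) (x : ℤ) :
    x ∈ beta lam ↔
      x < P x ∧ ((∃ i, startPos e h i = x + e) → ∃ i, startPos e h i = x) ∨
      P x ≤ x ∧ (∃ i, startPos e h i = x) ∧ ¬ ∃ i, startPos e h i = x + e := by
  have hpos := NeZero.pos e
  have a1 := ha.gap_add_le x
  have a2 := ha.top_cases x
  have a3 : ∀ c : ℤ, (c : ZMod e) = x → c < x → c + e ≤ x :=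
    fun c hc hlt => add_le_of_lt_of_cast_eq hlt hc
  have a4 : ∀ c : ℤ, (c : ZMod e) = x → x < c → x + e ≤ c :=
    fun c hc hlt => add_le_of_lt_of_cast_eq hlt hc.symm
  have b1 := a3 _ (ha.base_cast x)
  have b2 := a3 _ (ha.gap_cast x)
  have b3 := a3 _ (ha.top_cast x)
  have c1 := a4 _ (ha.base_cast x)
  have c2 := a4 _ (ha.gap_cast x)
  have c3 := a4 _ (ha.top_cast x)
  simp only [ha.exists_startPos_iff h, intCast_add_self, ha.mem_beta_self]
  omega

end Realization

/-! ### Solid parallelotopes as sets of subgradients -/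

section Solid

variable {e : ℕ} {lam : YoungDiagram} {w : ℕ}

/-- The parallelotope is the affine image of the vertices of the unit cube. -/
theorem mem_solid_iff_exists (h : eWeight e lam = w) (x : Fin w → ℝ) :
    x ∈ solid e h ↔ ∃ a : Fin w → ℝ, (∀ i, 0 ≤ a i ∧ a i ≤ 1) ∧
      x = toReal (label e h) + ∑ i, a i • toReal (eps e h i) := by
  let f : (Fin w → ℝ) →ᵃ[ℝ] (Fin w → ℝ) :=
    AffineMap.const ℝ _ (toReal (label e h)) +
      (Fintype.linearCombination ℝ fun i => toReal (eps e h i)).toAffineMap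
  have hf : ∀ a, f a = toReal (label e h) + ∑ i, a i • toReal (eps e h i) := fun a => by
    simp [f, Fintype.linearCombination_apply]
  have h1 : toReal '' parallelotope e h = f '' Set.univ.pi fun _ => {0, 1} := by
    ext y
    simp only [parallelotope, Set.mem_image, Set.mem_range, exists_exists_eq_and, Set.mem_pi,
      Set.mem_univ, true_implies, Set.mem_insert_iff, Set.mem_singleton_iff, hf]
    have hcast : ∀ G : Finset (Fin w), toReal (label e h + ∑ i ∈ G, eps e h i) =
        toReal (label e h) + ∑ i, (if i ∈ G then (1 : ℝ) else 0) • toReal (eps e h i) := by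
      intro G
      ext m
      simp [toReal]
    constructor
    · rintro ⟨G, rfl⟩
      exact ⟨fun i => if i ∈ G then 1 else 0, fun i => by by_cases hi : i ∈ G <;> simp [hi],
        (hcast G).symm⟩
    · rintro ⟨a, ha, rfl⟩
      classical
      refine ⟨Finset.univ.filter fun i => a i = 1, ?_⟩
      rw [hcast]
      congr 1
      refine Finset.sum_congr rfl fun i _ => ?_
      rcases ha i with hi | hi <;> simp [hi]
  rw [solid, h1, ← f.image_convexHull, convexHull_pi]
  simp only [convexHull_pair, segment_eq_Icc zero_le_one, Set.mem_image, Set.mem_pi, Set.mem_univ,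
    true_implies, Set.mem_Icc, hf, eq_comm (a := x)]

variable [NeZero e] {P g T : ZMod e → ℤ}

theorem IsHookAbacus.mem_solid_iff (ha : IsHookAbacus P g T lam) (h : eWeight e lam = w)
    (x : Fin w → ℝ) : x ∈ solid e h ↔ IsSubgradient P (startPos e h) x := by
  rw [mem_solid_iff_exists, isSubgradient_iff P ha.base_cast (ha.isHookConfig h)
    (ha.isTightBasis h), ← ha.label_eq h]
  simp only [eq_add_sum_basis_iff P ha.base_cast (ha.isHookConfig h) (ha.isTightBasis h)]
  constructor
  · rintro ⟨a, h1, h2⟩ i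
    rw [← h2 i]
    exact h1 i
  · intro h1
    exact ⟨_, h1, fun i => rfl⟩

theorem IsHookAbacus.mem_halfOpenSolid_iff (ha : IsHookAbacus P g T lam) (h : eWeight e lam = w)
    (x : Fin w → ℝ) : x ∈ halfOpenSolid e h ↔
      IsSubgradient P (startPos e h) x ∧
        ∀ i, ∑ k ∈ dualSet P (startPos e h) i, (x k - slope P (startPos e h) k) < 1 := by
  rw [isSubgradient_iff P ha.base_cast (ha.isHookConfig h)
    (ha.isTightBasis h), halfOpenSolid, Set.mem_ofPred_eq, ← ha.label_eq h]
  simp only [eq_add_sum_basis_iff P ha.base_cast (ha.isHookConfig h) (ha.isTightBasis h)]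
  constructor
  · rintro ⟨a, h1, h2⟩
    simp only [← h2]
    exact ⟨fun i => ⟨(h1 i).1, (h1 i).2.le⟩, fun i => (h1 i).2⟩
  · rintro ⟨h1, h3⟩
    exact ⟨_, fun i => ⟨(h1 i).1, h3 i⟩, fun i => rfl⟩

/-- A point of the half-open solid can be moved a little in all positive directions, since the
coordinates in the basis `ε` are sums of standard coordinates. -/
theorem IsHookAbacus.exists_add_isSubgradient (ha : IsHookAbacus P g T lam)
    (h : eWeight e lam = w) {x : Fin w → ℝ} (hx : x ∈ halfOpenSolid e h) :
    ∃ δ : ℝ, 0 < δ ∧ ∀ u : Fin w → ℝ, (∀ i, 0 ≤ u i) → ∑ i, u i ≤ δ →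
      IsSubgradient P (startPos e h) (x + u) := by
  rw [ha.mem_halfOpenSolid_iff, isSubgradient_iff P ha.base_cast (ha.isHookConfig h)
    (ha.isTightBasis h)] at hx
  obtain ⟨h0, h1⟩ := hx
  have hev : ∀ᶠ δ : ℝ in nhdsWithin 0 (Set.Ioi 0), 0 < δ ∧ ∀ i,
      δ ≤ 1 - ∑ k ∈ dualSet P (startPos e h) i, (x k - slope P (startPos e h) k) :=
    Filter.Eventually.and self_mem_nhdsWithin (Filter.eventually_all.2 fun i =>
      Filter.mem_of_superset (Ioc_mem_nhdsGT (sub_pos.2 (h1 i))) fun δ hδ => hδ.2)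
  obtain ⟨δ, hδ, hδ1⟩ := hev.exists
  refine ⟨δ, hδ, fun u hu hsum => ?_⟩
  rw [isSubgradient_iff P ha.base_cast (ha.isHookConfig h) (ha.isTightBasis h)]
  intro i
  have h2 : 0 ≤ ∑ k ∈ dualSet P (startPos e h) i, u k := Finset.sum_nonneg fun k _ => hu k
  have h3 : ∑ k ∈ dualSet P (startPos e h) i, u k ≤ ∑ k, u k :=
    Finset.sum_le_sum_of_subset_of_nonneg (Finset.subset_univ _) fun k _ _ => hu k
  have h4 : ∑ k ∈ dualSet P (startPos e h) i, ((x + u) k - slope P (startPos e h) k) =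
      ∑ k ∈ dualSet P (startPos e h) i, (x k - slope P (startPos e h) k) +
        ∑ k ∈ dualSet P (startPos e h) i, u k := by
    rw [← Finset.sum_add_distrib]
    refine Finset.sum_congr rfl fun k _ => ?_
    rw [Pi.add_apply]
    ring
  rw [h4]
  have := (h0 i).1
  have := hδ1 i
  constructor <;> linarith

end Solid

/-! ### The tiling -/

section Tiling

open Filter Topology

variable {e : ℕ} [NeZero e] {w : ℕ} {P : ZMod e → ℤ}

theorem isClosed_isSubgradient (q : Fin w → ℤ) :
    IsClosed {x : Fin w → ℝ | IsSubgradient P q x} := by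
  simp only [IsSubgradient, Set.ofPred_forall]
  exact isClosed_iInter fun v => isClosed_le (by fun_prop) continuous_const

theorem exists_frequently_isSubgradient (hP : ∀ r, ((P r : ℤ) : ZMod e) = r)
    {y : ℝ → Fin w → ℝ} (hy : ∀ᶠ t in 𝓝[>] 0, (∀ i, 0 < y t i ∧ y t i < e) ∧
      ∀ i j : Fin w, (i : ℕ) + 1 = j → 3 < y t j - y t i) :
    ∃ q, IsHookConfig P q ∧ ∃ᶠ t in 𝓝[>] 0, IsSubgradient P q (y t) := by
  by_contra! hne
  have h1 : ∀ᶠ t in 𝓝[>] (0 : ℝ), ∀ q ∈ {q : Fin w → ℤ | IsHookConfig P q},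
      ¬ IsSubgradient P q (y t) :=
    (eventually_all_finite (finite_hookConfig P)).2 fun q hq => by
      simpa [Filter.Frequently] using hne q hq
  obtain ⟨t, h2, h3, h4⟩ := (h1.and hy).exists
  obtain ⟨q, hq, hs⟩ := exists_hookConfig P hP h3 h4
  exact h2 q hq hs

theorem IsSubgradient.mem_cube {q : Fin w → ℤ} {x : Fin w → ℝ} (h : IsSubgradient P q x)
    (hx : Monotone x) : x ∈ cube e w := by
  intro i
  have hw := i.pos
  have h0 : IsBot (⟨0, hw⟩ : Fin w) := fun j => Fin.le_def.2 (Nat.zero_le _)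
  have h1 : IsTop (⟨w - 1, by omega⟩ : Fin w) := fun j => Fin.le_def.2 (by have := j.2; simp; omega)
  exact ⟨(h.nonneg_of_isBot h0).trans (hx (h0 i)), (hx (h1 i)).trans (h.le_of_isTop h1)⟩

theorem monotone_of_mem_increasing {x : Fin w → ℝ} {O : Set (Fin w → ℝ)}
    (hx : x ∈ increasing 4 O) : Monotone x :=
  monotone_of_consecutive fun i j hij => by linarith [hx.2 i j hij]

theorem pairwise_disjoint_increasing_halfOpenSolid {kap : YoungDiagram}
    (hP : ∀ r, ((P r : ℤ) : ZMod e) = r) (hbase : ∀ x : ℤ, x ∈ beta kap ↔ x < P x) :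
    Pairwise (fun lam mu : hookQuotientBlock e kap w =>
      Disjoint (increasing 4 (halfOpenSolid e lam.2.1.2))
        (increasing 4 (halfOpenSolid e mu.2.1.2))) := by
  choose g T ha using fun lam : hookQuotientBlock e kap w => exists_isHookAbacus hP hbase lam.2
  refine fun lam mu hne => Set.disjoint_left.2 fun x hx hy => hne ?_
  obtain ⟨δ₁, hδ₁, h1⟩ := (ha lam).exists_add_isSubgradient lam.2.1.2 hx.1
  obtain ⟨δ₂, hδ₂, h2⟩ := (ha mu).exists_add_isSubgradient mu.2.1.2 hy.1
  have key : ∀ u : Fin w → ℝ, (∀ i, 0 ≤ u i) → ∑ i, u i ≤ min δ₁ δ₂ →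
      ∑ i, (x i + u i) * (startPos e lam.2.1.2 i : ℝ) - energy P (startPos e lam.2.1.2) =
      ∑ i, (x i + u i) * (startPos e mu.2.1.2 i : ℝ) - energy P (startPos e mu.2.1.2) :=
    fun u hu hsum => le_antisymm
      (isSubgradient_iff_forall_le.1 (h2 u hu (hsum.trans (min_le_right _ _))) _)
      (isSubgradient_iff_forall_le.1 (h1 u hu (hsum.trans (min_le_left _ _))) _)
  have hδ : 0 < min δ₁ δ₂ := lt_min hδ₁ hδ₂
  have hq : startPos e lam.2.1.2 = startPos e mu.2.1.2 := by
    ext k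
    have h3 := key 0 (fun i => le_rfl) (by simpa using hδ.le)
    have h4 := key (Pi.single k (min δ₁ δ₂)) (fun i => by
      by_cases hi : i = k
      · subst hi
        simpa using hδ.le
      · simp [hi]) (by simp)
    simp only [add_mul, Finset.sum_add_distrib, Pi.single_apply, ite_mul, zero_mul,
      Finset.sum_ite_eq', Finset.mem_univ, if_true, Pi.zero_apply, add_zero] at h3 h4
    have h5 : min δ₁ δ₂ * (startPos e lam.2.1.2 k : ℝ) =
        min δ₁ δ₂ * (startPos e mu.2.1.2 k : ℝ) := by linarith
    exact_mod_cast mul_left_cancel₀ hδ.ne' h5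
  refine Subtype.ext (beta_injective (Set.ext fun y => ?_))
  rw [(ha lam).mem_beta_iff_exists lam.2.1.2, (ha mu).mem_beta_iff_exists mu.2.1.2, hq]

theorem iUnion_increasing_halfOpenSolid {kap : YoungDiagram}
    (hP : ∀ r, ((P r : ℤ) : ZMod e) = r) (hbase : ∀ x : ℤ, x ∈ beta kap ↔ x < P x) :
    (⋃ lam : hookQuotientBlock e kap w, increasing 4 (halfOpenSolid e lam.2.1.2)) =
      increasing 4 (halfOpenCube e w) := by
  choose g T ha using fun lam : hookQuotientBlock e kap w => exists_isHookAbacus hP hbase lam.2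
  refine Set.Subset.antisymm ?_ ?_
  · refine Set.iUnion_subset fun lam x hx => ⟨fun i => ?_, hx.2⟩
    have hmono := monotone_of_mem_increasing hx
    obtain ⟨δ, hδ, h1⟩ := (ha lam).exists_add_isSubgradient lam.2.1.2 hx.1
    have h2 := h1 0 (fun i => le_rfl) (by simpa using hδ.le)
    rw [add_zero] at h2
    refine ⟨(h2.mem_cube hmono i).1, ?_⟩
    have hw := i.pos
    have htop : IsTop (⟨w - 1, by omega⟩ : Fin w) :=
      fun j => Fin.le_def.2 (by have := j.2; simp; omega)
    have h3 := (h1 (Pi.single ⟨w - 1, by omega⟩ δ) (fun j => by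
      rw [Pi.single_apply]
      split_ifs
      exacts [hδ.le, le_rfl]) (by simp)).le_of_isTop htop
    rw [Pi.add_apply, Pi.single_eq_same] at h3
    linarith [hmono (htop i)]
  · rintro x ⟨hx, hinc⟩
    have htend : Tendsto (fun t : ℝ => fun i => x i + t) (𝓝[>] 0) (𝓝 x) := by
      have : Continuous fun t : ℝ => fun i : Fin w => x i + t := by fun_prop
      have h0 := this.tendsto 0
      simp only [add_zero] at h0
      exact h0.mono_left nhdsWithin_le_nhds
    obtain ⟨q, hq, hfreq⟩ := exists_frequently_isSubgradient (P := P) hP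
      (y := fun t i => x i + t) (by
        have h1 : ∀ᶠ t : ℝ in 𝓝[>] 0, ∀ i, t < e - x i := eventually_all.2 fun i =>
          mem_of_superset (Ioo_mem_nhdsGT (sub_pos.2 (hx i).2)) fun t ht => ht.2
        filter_upwards [h1, self_mem_nhdsWithin] with t ht ht0
        have ht0 : 0 < t := ht0
        refine ⟨fun i => ⟨by linarith [(hx i).1], by linarith [ht i]⟩, fun i j hij => ?_⟩
        linarith [hinc i j hij])
    obtain ⟨lam, rfl⟩ := exists_partition hP hbase hq
    refine Set.mem_iUnion.2 ⟨lam, ?_, hinc⟩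
    rw [(ha lam).mem_halfOpenSolid_iff]
    refine ⟨(isClosed_isSubgradient _).mem_of_frequently_of_tendsto hfreq htend, fun i => ?_⟩
    obtain ⟨t, ht, ht0⟩ := (hfreq.and_eventually self_mem_nhdsWithin).exists
    have ht0 : 0 < t := ht0
    have h1 := ((isSubgradient_iff P hP hq ((ha lam).isTightBasis _) _).1 ht i).2
    refine lt_of_lt_of_le (Finset.sum_lt_sum_of_nonempty ⟨i, ?_⟩ fun k _ => ?_) h1
    · exact mem_dualSet.2 ⟨rfl, fun _ => le_rfl, fun _ => le_rfl⟩
    · linarith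

theorem iUnion_increasing_solid {kap : YoungDiagram}
    (hP : ∀ r, ((P r : ℤ) : ZMod e) = r) (hbase : ∀ x : ℤ, x ∈ beta kap ↔ x < P x) :
    (⋃ lam : hookQuotientBlock e kap w, increasing 4 (solid e lam.2.1.2)) =
      increasing 4 (cube e w) := by
  have he0 : (0 : ℝ) < e := by exact_mod_cast NeZero.pos e
  choose g T ha using fun lam : hookQuotientBlock e kap w => exists_isHookAbacus hP hbase lam.2
  refine Set.Subset.antisymm ?_ ?_
  · refine Set.iUnion_subset fun lam x hx => ⟨?_, hx.2⟩
    exact (((ha lam).mem_solid_iff _ x).1 hx.1).mem_cube (monotone_of_mem_increasing hx)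
  · rintro x ⟨hx, hinc⟩
    have htend : Tendsto (fun t : ℝ => fun i => (1 - t) * x i + t * (e / 2)) (𝓝[>] 0) (𝓝 x) := by
      have : Continuous fun t : ℝ => fun i : Fin w => (1 - t) * x i + t * (e / 2) := by fun_prop
      have h0 := this.tendsto 0
      simp only [sub_zero, one_mul, zero_mul, add_zero] at h0
      exact h0.mono_left nhdsWithin_le_nhds
    obtain ⟨q, hq, hfreq⟩ := exists_frequently_isSubgradient (P := P) hP
      (y := fun t i => (1 - t) * x i + t * (e / 2)) (by
        -- for `t < 1 / 4` the coordinates still increase by `4 * (1 - t) > 3`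
        filter_upwards [Ioo_mem_nhdsGT (show (0 : ℝ) < 1 / 4 by norm_num)] with t ht
        obtain ⟨ht0, ht1⟩ := ht
        refine ⟨fun i => ⟨?_, ?_⟩, fun i j hij => ?_⟩
        · have h1 := mul_nonneg (by linarith : 0 ≤ 1 - t) (hx i).1
          have h2 := mul_pos ht0 he0
          linarith
        · have h1 := mul_nonneg (by linarith : 0 ≤ 1 - t) (sub_nonneg.2 (hx i).2)
          have h2 := mul_pos ht0 he0
          linarith
        · have h1 := mul_nonneg (by linarith : 0 ≤ 1 - t) (sub_nonneg.2 (hinc i j hij))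
          linarith)
    obtain ⟨lam, rfl⟩ := exists_partition hP hbase hq
    refine Set.mem_iUnion.2 ⟨lam, ?_, hinc⟩
    rw [(ha lam).mem_solid_iff]
    exact (isClosed_isSubgradient _).mem_of_frequently_of_tendsto hfreq htend

end Tiling

end HookTiling

theorem proposition8p3 (e : ℕ) (he : 2 ≤ e) (kap : YoungDiagram) (hkap : HookTiling.IsECore e kap)
    (w : ℕ) :
    Pairwise (fun lam mu : HookTiling.hookQuotientBlock e kap w =>
      Disjoint (HookTiling.increasing 4 (HookTiling.halfOpenSolid e lam.2.1.2))
        (HookTiling.increasing 4 (HookTiling.halfOpenSolid e mu.2.1.2))) ∧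
    (⋃ lam : HookTiling.hookQuotientBlock e kap w,
      HookTiling.increasing 4 (HookTiling.halfOpenSolid e lam.2.1.2)) =
        HookTiling.increasing 4 (HookTiling.halfOpenCube e w) ∧
    (⋃ lam : HookTiling.hookQuotientBlock e kap w,
      HookTiling.increasing 4 (HookTiling.solid e lam.2.1.2)) =
        HookTiling.increasing 4 (HookTiling.cube e w) := by
  have : NeZero e := ⟨by omega⟩
  obtain ⟨P, hP, hbase⟩ := HookTiling.exists_base_of_isECore hkap
  exact ⟨HookTiling.pairwise_disjoint_increasing_halfOpenSolid hP hbase,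
    HookTiling.iUnion_increasing_halfOpenSolid hP hbase,
    HookTiling.iUnion_increasing_solid hP hbase⟩
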